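/- A \emph{Cantor minimal $G$-system} is a free action $\phi\colon G\to\operatorname{Homeo}(X)$ of a countable discrete group $G$ on a Cantor set $X$ such that every class of $\mathcal R_\phi=\{(x,\phi^g(x)) : x\in X,\ g\in G\}$ is dense; $\mathcal R_\phi$ carries the topology transferred from $X\times G$ by the bijection $(x,g)\mapsto(x,\phi^g(x))$. A homeomorphism $f$ is identified with the $\mathbb Z$-action $n\mapsto f^n$. An equivalence relation with a topology on its graph is \emph{étale} if it is a locally compact, Hausdorff, second countable topological groupoid for which $(x,y)\mapsto x$ is a local homeomorphism; it is \emph{minimal} if all its classes are dense, and \emph{AF} if it is étale and an increasing union of a sequence of compact open subequivalence relations. For an étale equivalence relation $\mathcal R$ on $X$, a closed set $Y\subset X$ is \emph{$\mathcal R$-étale} if $\mathcal R\cap(Y\times Y)$, with the relative topology, is an étale equivalence relation on $Y$, and \emph{thin} if $\mu(Y)=0$ for every $\mathcal R$-invariant Borel probability measure $\mu$ on $X$ (that is, $\mu(r(U))=\mu(s(U))$ for each open $U\subset\mathcal R$ on which both coordinate projections $r(x,y)=x$ and $s(x,y)=y$ are injective). \textbf{Theorem.} Let $(X_1,\phi_1)$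 and $(X_2,\phi_2)$ be two Cantor minimal $\mathbb Z$-systems, and let $p_1\in X_1$, $p_2\in X_2$. Let $U_1\subset X_1$ and $U_2\subset X_2$ be non-empty clopen subsets such that $p_i$ and $\phi_i(p_i)$ do not belong to $U_i$, $i=1,2$. Put $$B=(\{p_1\}\times U_2)\cup(U_1\times\{p_2\}),\qquad B^*=(\{\phi_1(p_1)\}\times U_2)\cup(U_1\times\{\phi_2(p_2)\}),$$ and define $\beta\colon B\to B^*$ by $\beta(p_1,x_2)=(\phi_1(p_1),x_2)$ for $x_2\in U_2$ and $\beta(x_1,p_2)=(x_1,\phi_2(p_2))$ for $x_1\in U_1$. Let $\phi$ be the $\mathbb Z^2$-action on $X=X_1\times X_2$ given by $\phi^{(m,n)}=\phi_1^m\times\phi_2^n$, and put $p=(p_1,p_2)$. Then there is a subequivalence relation $\mathcal R'\subset\mathcal R_\phi$, which we equip with the relative topology from $\mathcal R_\phi$, such that: \begin{enumerate} \item $\mathcal R'$ is a minimal AF equivalence relation. \item Both $B$ and $B^*$ are closed, $\mathcal R'$-étale and thin (for $\mathcal R'$). \item $\mathcal R'\cap(B\times B^*)$ is empty. \item $\beta$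 induces an isomorphism between $\mathcal R'\cap(B\times B)$ and $\mathcal R'\cap(B^*\times B^*)$: $\beta$ is a homeomorphism, and $\beta\times\beta$ is a homeomorphism of the first relation onto the second, both with the relative topology. \item The equivalence relation $\mathcal R_\phi$ is generated by $\mathcal R'$, the graph of $\beta$ and $$\{(p,\phi^{(0,1)}(p)),\ (\phi^{(0,1)}(p),\phi^{(1,1)}(p)),\ (\phi^{(1,1)}(p),\phi^{(1,0)}(p))\}.$$ \end{enumerate} -/

import Mathlib

open Set Topology

namespace CantorOrbit

/-- `X` is a Cantor set. -/
def IsCantorSet (X : Type*) [TopologicalSpace X] : Prop :=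
  Nonempty (X ≃ₜ (ℕ → Bool))

/-! ### Equivalence relations with a topology on their graph -/

/-- The graph `{(x, y) : x R y}` of an equivalence relation, as a bare type: it carries no
topology of its own (in particular not the one of `X × X`). -/
@[ext]
structure RelGraph {X : Type*} (R : Setoid X) where
  fst : X
  snd : X
  rel : R fst snd

namespace RelGraph

variable {X Y : Type*} {R : Setoid X} {S : Setoid Y}

/-- The inverse `(x, y) ↦ (y, x)`. -/
def inv (q : RelGraph R) : RelGraph R := ⟨q.snd, q.fst, R.symm q.rel⟩

/-- The product `(x, y)(y, z) = (x, z)` of composable pairs. -/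
def mul (q : {q : RelGraph R × RelGraph R // q.1.snd = q.2.fst}) : RelGraph R :=
  ⟨q.1.1.fst, q.1.2.snd, R.trans q.1.1.rel (q.2 ▸ q.1.2.rel)⟩

/-- The map `(x, y) ↦ (f x, f y)`, for `f` that maps `R` into `S`. -/
def map (f : X → Y) (h : ∀ x y, R x y → S (f x) (f y)) (q : RelGraph R) : RelGraph S :=
  ⟨f q.fst, f q.snd, h _ _ q.rel⟩

end RelGraph

/-- `(R, T)` is an étale equivalence relation on `X`: a locally compact Hausdorff second countable
topological groupoid whose range map `(x, y) ↦ x` is a local homeomorphism onto `X`. -/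
structure IsEtale {X : Type*} [TopologicalSpace X] (R : Setoid X)
    (T : TopologicalSpace (RelGraph R)) : Prop where
  t2Space : T2Space (RelGraph R)
  locallyCompactSpace : LocallyCompactSpace (RelGraph R)
  secondCountableTopology : SecondCountableTopology (RelGraph R)
  continuous_inv : Continuous (RelGraph.inv : RelGraph R → RelGraph R)
  continuous_mul :
    Continuous (RelGraph.mul : {q : RelGraph R × RelGraph R // q.1.snd = q.2.fst} → RelGraph R)
  isLocalHomeomorph_fst : IsLocalHomeomorph (RelGraph.fst : RelGraph R → X)

/-- `R` is minimal: every class is dense. -/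
def IsMinimalRel {X : Type*} [TopologicalSpace X] (R : Setoid X) : Prop :=
  ∀ x, Dense {y | R x y}

/-- `(R, T)` is an AF equivalence relation: it is étale, and an increasing union of compact open
subequivalence relations. -/
def IsAF {X : Type*} [TopologicalSpace X] (R : Setoid X)
    (T : TopologicalSpace (RelGraph R)) : Prop :=
  IsEtale R T ∧ ∃ K : ℕ → Setoid X, Monotone K ∧ (∀ n, K n ≤ R) ∧
    (∀ n, IsCompact {q : RelGraph R | K n q.fst q.snd} ∧ IsOpen {q : RelGraph R | K n q.fst q.snd}) ∧
    ∀ x y, R x y → ∃ n, K n x y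

/-- The relative topology on a subequivalence relation `R' ≤ R`. -/
abbrev subTopology {X : Type*} {R' R : Setoid X} (h : R' ≤ R)
    (T : TopologicalSpace (RelGraph R)) : TopologicalSpace (RelGraph R') :=
  T.induced (RelGraph.map id fun _ _ hxy => h hxy)

/-- The restriction `R ∩ (Y × Y)`, an equivalence relation on `Y`. -/
def restrictRel {X : Type*} (R : Setoid X) (Y : Set X) : Setoid Y :=
  R.comap Subtype.val

/-- The relative topology on `R ∩ (Y × Y)`. -/
abbrev restrictTopology {X : Type*} {R : Setoid X} (T : TopologicalSpace (RelGraph R)) (Y : Set X) :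
    TopologicalSpace (RelGraph (restrictRel R Y)) :=
  T.induced (RelGraph.map Subtype.val fun _ _ hxy => hxy)

/-- The subset `Y` is `R`-étale: `R ∩ (Y × Y)` with the relative topology is an étale equivalence
relation on `Y`. -/
def IsEtaleSubset {X : Type*} [TopologicalSpace X] (R : Setoid X)
    (T : TopologicalSpace (RelGraph R)) (Y : Set X) : Prop :=
  IsEtale (restrictRel R Y) (restrictTopology T Y)

/-- The Borel measure `μ` is `R`-invariant: `μ (r(U)) = μ (s(U))` for each open set `U ⊆ R` on
which both projections are injective. -/
def IsInvariantMeasure {X : Type*} [TopologicalSpace X] (R : Setoid X)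
    (T : TopologicalSpace (RelGraph R)) (μ : @MeasureTheory.Measure X (borel X)) : Prop :=
  ∀ U : Set (RelGraph R), IsOpen U → InjOn RelGraph.fst U → InjOn RelGraph.snd U →
    μ (RelGraph.fst '' U) = μ (RelGraph.snd '' U)

/-- The subset `Y` is thin: it is null for every `R`-invariant Borel probability measure. -/
def IsThin {X : Type*} [TopologicalSpace X] (R : Setoid X)
    (T : TopologicalSpace (RelGraph R)) (Y : Set X) : Prop :=
  ∀ μ : @MeasureTheory.Measure X (borel X), @MeasureTheory.IsProbabilityMeasure X (borel X) μ →
    IsInvariantMeasure R T μ → μ Y = 0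

/-- The map `f : X → Y` induces an isomorphism of `(R, T)` onto `(S, T')`: it is a homeomorphism,
and `f × f` is a homeomorphism of `R` onto `S`. -/
def InducesIso {X Y : Type*} [TopologicalSpace X] [TopologicalSpace Y]
    (R : Setoid X) (T : TopologicalSpace (RelGraph R))
    (S : Setoid Y) (T' : TopologicalSpace (RelGraph S)) (f : X → Y) : Prop :=
  IsHomeomorph f ∧ ∃ h : ∀ x y, R x y ↔ S (f x) (f y),
    IsHomeomorph (RelGraph.map f fun x y => (h x y).1 : RelGraph R → RelGraph S)

/-! ### Orbit equivalence relations -/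

/-- The orbit equivalence relation `R_φ = {(x, φ^g x)}`. -/
def orbitRel {X G : Type*} [TopologicalSpace X] [Group G] (φ : G →* (X ≃ₜ X)) : Setoid X where
  r x y := ∃ g, φ g x = y
  iseqv :=
    { refl := fun x => ⟨1, by simp⟩
      symm := by
        rintro x _ ⟨g, rfl⟩
        refine ⟨g⁻¹, ?_⟩
        rw [← Homeomorph.mul_apply, ← map_mul]
        simp
      trans := by
        rintro x _ _ ⟨g, rfl⟩ ⟨k, rfl⟩
        exact ⟨k * g, by rw [map_mul, Homeomorph.mul_apply]⟩ }

/-- The topology of `R_φ`, transferred from `X × G` (with `G` discrete) along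
`(x, g) ↦ (x, φ^g x)`, which is a bijection when `φ` is free. -/
abbrev orbitTopology {X G : Type*} [TopologicalSpace X] [Group G] (φ : G →* (X ≃ₜ X)) :
    TopologicalSpace (RelGraph (orbitRel φ)) :=
  letI : TopologicalSpace G := ⊥
  TopologicalSpace.coinduced
    (fun q : X × G => (⟨q.1, φ q.2 q.1, ⟨q.2, rfl⟩⟩ : RelGraph (orbitRel φ))) inferInstance

/-- `(X, φ)` is a Cantor minimal `G`-system: `X` is a Cantor set, `φ` is free and `R_φ` is
minimal. -/
structure IsCantorMinimalSystem {X G : Type*} [TopologicalSpace X] [Group G]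
    (φ : G →* (X ≃ₜ X)) : Prop where
  isCantorSet : IsCantorSet X
  free : ∀ g, g ≠ 1 → ∀ x, φ g x ≠ x
  isMinimalRel : IsMinimalRel (orbitRel φ)

/-- The `ℤ`-action `n ↦ f ^ n` of a homeomorphism `f`. -/
def intAction {X : Type*} [TopologicalSpace X] (f : X ≃ₜ X) : Multiplicative ℤ →* (X ≃ₜ X) :=
  zpowersHom (X ≃ₜ X) f

/-- The `ℤ²`-action induced by `φ₁ × id` and `id × φ₂`, that is
`(m, n) ↦ φ₁ ^ m × φ₂ ^ n`. -/
def prodAction {X₁ X₂ : Type*} [TopologicalSpace X₁] [TopologicalSpace X₂]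
    (φ₁ : X₁ ≃ₜ X₁) (φ₂ : X₂ ≃ₜ X₂) :
    Multiplicative (ℤ × ℤ) →* (X₁ × X₂ ≃ₜ X₁ × X₂) where
  toFun a := (φ₁ ^ a.toAdd.1).prodCongr (φ₂ ^ a.toAdd.2)
  map_one' := by ext x <;> simp
  map_mul' a b := by ext x <;> simp [zpow_add]

/-! ### The sets `B`, `B*` and the map `β` -/

/-- The set `({q₁} × U₂) ∪ (U₁ × {q₂})`. It is `B` for `q = p`, and `B*` for
`q = (φ₁ p₁, φ₂ p₂)`. -/
def cross {X₁ X₂ : Type*} (U₁ : Set X₁) (U₂ : Set X₂) (q₁ : X₁) (q₂ : X₂) : Set (X₁ × X₂) :=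
  ({q₁} ×ˢ U₂) ∪ (U₁ ×ˢ {q₂})

open Classical in
/-- The map `β : B → B*`: `(p₁, x₂) ↦ (q₁, x₂)` for `x₂ ∈ U₂` and `(x₁, p₂) ↦ (x₁, q₂)` for
`x₁ ∈ U₁`. -/
noncomputable def beta {X₁ X₂ : Type*} (U₁ : Set X₁) (U₂ : Set X₂)
    (p₁ : X₁) (p₂ : X₂) (q₁ : X₁) (q₂ : X₂) (x : cross U₁ U₂ p₁ p₂) : cross U₁ U₂ q₁ q₂ :=
  if h : x.1 ∈ ({p₁} : Set X₁) ×ˢ U₂ then ⟨(q₁, x.1.2), Or.inl ⟨rfl, h.2⟩⟩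
  else ⟨(x.1.1, q₂), Or.inr ⟨(x.2.resolve_left h).1, rfl⟩⟩

theorem beta_left {X₁ X₂ : Type*} (U₁ : Set X₁) (U₂ : Set X₂)
    (p₁ : X₁) (p₂ : X₂) (q₁ : X₁) (q₂ : X₂) {x₂ : X₂} (hx : x₂ ∈ U₂) :
    beta U₁ U₂ p₁ p₂ q₁ q₂ ⟨(p₁, x₂), Or.inl ⟨rfl, hx⟩⟩ = ⟨(q₁, x₂), Or.inl ⟨rfl, hx⟩⟩ := by
  simp [beta, hx]

theorem beta_right {X₁ X₂ : Type*} (U₁ : Set X₁) (U₂ : Set X₂)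
    (p₁ : X₁) (p₂ : X₂) (q₁ : X₁) (q₂ : X₂) (hp : p₁ ∉ U₁) {x₁ : X₁} (hx : x₁ ∈ U₁) :
    beta U₁ U₂ p₁ p₂ q₁ q₂ ⟨(x₁, p₂), Or.inr ⟨hx, rfl⟩⟩ = ⟨(x₁, q₂), Or.inr ⟨hx, rfl⟩⟩ := by
  have : x₁ ≠ p₁ := fun h => hp (h ▸ hx)
  simp [beta, this]

end CantorOrbit

open CantorOrbit

/-! For each factor take clopen sets shrinking to the image of the marked point. The segments
between consecutive visits to the sets are finite intervals, growing with the level. Their union is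
the orbit relation cut between the marked point and its image (`exists_towers`). Products of
intervals are tiles, and the union of the tile relations is AF: an orbit off both cuts is one class,
an orbit meeting one cut gives two half planes, and the orbit of `p` gives four quadrants.

This plain product relation is too large for `β`. In a quadrant it relates points of the vertical
part of `B` to points of the horizontal part, but `β` moves the two parts across different cuts,
into quadrants that are not related. So each quadrant has to be split into a vertical piece and a
horizontal piece, the first containing the vertical side and the second the horizontal side, with a
choice still to be made at the corner. This is done at every finite level, by dividing only the
tiles that sit at a corner of the next tile. If that tile is again at the same corner of the tile
above, its division is passed on; otherwise the whole tile joins a single piece one level up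
(`tileRel_succ_of_ne`). Hence the relations increase (`monotone_tileRel`), and a division survives
in the limit only where a tile sits at the same corner forever, that is in the four quadrants
(`limitRel_or_corner`). Each piece is still large enough for minimality.

On `B` and on `B*` the vertical and horizontal parts are now unrelated, each carrying the cut
relation of one factor, and `β` preserves these. The orbit of `p` consists of eight pieces. `β`
glues them in four pairs: vertical pieces across the vertical cut, horizontal pieces across the
horizontal cut. The corners with equal sides lie in vertical pieces and the other two in horizontal
ones, so the three extra pairs, which run through the four corners in turn, join the four pairs of
pieces in a chain (`orbitRel_le_of_limitRel_le`).

Topologically, freeness turns any subrelation into a subset of space times group through `chart`;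
being étale then reduces to openness of the slice over each group element. Thinness holds because
each half of the cross has infinitely many disjoint translates of equal measure. -/

namespace CantorOrbit

/-! ### Visits of an orbit to a set -/

section Visits

variable {X : Type*} [TopologicalSpace X]

theorem zpow_succ_apply (f : X ≃ₜ X) (k : ℤ) (x : X) : (f ^ (k + 1)) x = (f ^ k) (f x) := by
  rw [zpow_add, zpow_one, Homeomorph.mul_apply]

theorem zpow_apply_comm (f : X ≃ₜ X) (k : ℤ) (x : X) : (f ^ k) (f x) = f ((f ^ k) x) := by
  rw [← zpow_succ_apply, add_comm, zpow_add, zpow_one, Homeomorph.mul_apply]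

theorem zpow_add_apply (f : X ≃ₜ X) (k l : ℤ) (x : X) :
    (f ^ (k + l)) x = (f ^ k) ((f ^ l) x) := by
  rw [zpow_add, Homeomorph.mul_apply]

theorem zpow_neg_zero_apply (f : X ≃ₜ X) (x : X) : (f ^ (-((0 : ℕ) : ℤ))) x = x := by
  rw [Nat.cast_zero, neg_zero, zpow_zero, Homeomorph.one_apply]

/-- The number of steps back to the last visit of `V`, the present included. -/
noncomputable def backTime (f : X ≃ₜ X) (V : Set X) (x : X) : ℕ :=
  sInf {i : ℕ | (f ^ (-(i : ℤ))) x ∈ V}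

/-- One less than the number of steps to the next visit of `V`, the present excluded. -/
noncomputable def fwdTime (f : X ≃ₜ X) (V : Set X) (x : X) : ℕ :=
  sInf {i : ℕ | (f ^ ((i : ℤ) + 1)) x ∈ V}

/-- The last visit of `V`, the present included. -/
noncomputable def lastVisit (f : X ≃ₜ X) (V : Set X) (x : X) : X :=
  (f ^ (-(backTime f V x : ℤ))) x

/-- The next visit of `V`, the present excluded. -/
noncomputable def nextVisit (f : X ≃ₜ X) (V : Set X) (x : X) : X :=
  (f ^ ((fwdTime f V x : ℤ) + 1)) x

/-- Every orbit visits `V` in the past and in the future. -/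
structure Recurrent (f : X ≃ₜ X) (V : Set X) : Prop where
  back : ∀ x, ∃ i : ℕ, (f ^ (-(i : ℤ))) x ∈ V
  fwd : ∀ x, ∃ i : ℕ, (f ^ ((i : ℤ) + 1)) x ∈ V

variable {f : X ≃ₜ X} {V V' : Set X}

/-- Induction on the number of steps since the last visit. With its forward counterpart it gives the
identities below without arithmetic on return times. -/
theorem Recurrent.back_induction (hV : Recurrent f V) {P : X → Prop}
    (mem : ∀ x ∈ V, P x) (step : ∀ x, f x ∉ V → P x → P (f x)) (x : X) : P x := by
  obtain ⟨i, hi⟩ := hV.back x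
  induction i generalizing x with
  | zero => exact mem x (by rwa [zpow_neg_zero_apply] at hi)
  | succ i ih =>
    obtain ⟨y, rfl⟩ := f.surjective x
    by_cases hy : f y ∈ V
    · exact mem _ hy
    · refine step y hy (ih y ?_)
      rw [← zpow_succ_apply] at hi
      convert hi using 3
      push_cast; ring

theorem Recurrent.fwd_induction (hV : Recurrent f V) {P : X → Prop}
    (mem : ∀ x, f x ∈ V → P x) (step : ∀ x, f x ∉ V → P (f x) → P x) (x : X) : P x := by
  obtain ⟨i, hi⟩ := hV.fwd x
  induction i generalizing x with
  | zero => exact mem x (by simpa using hi)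
  | succ i ih =>
    by_cases hy : f x ∈ V
    · exact mem _ hy
    · refine step x hy (ih _ ?_)
      rw [← zpow_succ_apply]
      exact_mod_cast hi

theorem lastVisit_of_mem {x : X} (hx : x ∈ V) : lastVisit f V x = x := by
  have : backTime f V x = 0 := by
    rw [backTime, Nat.sInf_eq_zero]; left
    rwa [mem_ofPred_eq, zpow_neg_zero_apply]
  simp [lastVisit, this]

theorem nextVisit_of_mem {x : X} (hx : f x ∈ V) : nextVisit f V x = f x := by
  have : fwdTime f V x = 0 := by
    rw [fwdTime, Nat.sInf_eq_zero]; left; simpa using hx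
  simp [nextVisit, this]

theorem sInf_succ_eq {s : Set ℕ} (h0 : 0 ∉ s) (hs : s.Nonempty) :
    sInf s = sInf {i | i + 1 ∈ s} + 1 := by
  have hne : {i | i + 1 ∈ s}.Nonempty := by
    obtain ⟨i, hi⟩ := hs
    cases i with
    | zero => exact absurd hi h0
    | succ i => exact ⟨i, hi⟩
  apply le_antisymm
  · exact Nat.sInf_le (Nat.sInf_mem hne)
  · have h1 := Nat.sInf_mem hs
    rcases h : sInf s with _ | k
    · rw [h] at h1; exact absurd h1 h0
    · rw [h] at h1
      exact Nat.succ_le_succ (Nat.sInf_le h1)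

theorem Recurrent.backTime_of_notMem (hV : Recurrent f V) {x : X} (hx : f x ∉ V) :
    backTime f V (f x) = backTime f V x + 1 := by
  rw [backTime, sInf_succ_eq (s := {i : ℕ | (f ^ (-(i : ℤ))) (f x) ∈ V})
    (by rwa [mem_ofPred_eq, zpow_neg_zero_apply]) (hV.back (f x)), backTime]
  congr 3
  ext i
  simp only [mem_ofPred_eq]
  rw [← zpow_succ_apply]
  congr! 3
  push_cast; ring

theorem Recurrent.fwdTime_of_notMem (hV : Recurrent f V) {x : X} (hx : f x ∉ V) :
    fwdTime f V x = fwdTime f V (f x) + 1 := by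
  rw [fwdTime, sInf_succ_eq (s := {i : ℕ | (f ^ ((i : ℤ) + 1)) x ∈ V})
    (by simpa using hx) (hV.fwd x), fwdTime]
  congr 3

theorem Recurrent.lastVisit_of_notMem (hV : Recurrent f V) {x : X} (hx : f x ∉ V) :
    lastVisit f V (f x) = lastVisit f V x := by
  rw [lastVisit, hV.backTime_of_notMem hx, lastVisit, ← zpow_succ_apply]
  congr! 2
  push_cast; ring

theorem Recurrent.nextVisit_of_notMem (hV : Recurrent f V) {x : X} (hx : f x ∉ V) :
    nextVisit f V x = nextVisit f V (f x) := by
  rw [nextVisit, hV.fwdTime_of_notMem hx, nextVisit, ← zpow_succ_apply]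
  push_cast; rfl

theorem Recurrent.lastVisit_mem (hV : Recurrent f V) (x : X) : lastVisit f V x ∈ V :=
  Nat.sInf_mem (hV.back x)

theorem Recurrent.nextVisit_mem (hV : Recurrent f V) (x : X) : nextVisit f V x ∈ V :=
  Nat.sInf_mem (hV.fwd x)

theorem Recurrent.nextVisit_lastVisit (hV : Recurrent f V) (x : X) :
    nextVisit f V (lastVisit f V x) = nextVisit f V x := by
  induction x using hV.back_induction with
  | mem x hx => rw [lastVisit_of_mem hx]
  | step x hx ih => rw [hV.lastVisit_of_notMem hx, ih, hV.nextVisit_of_notMem hx]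

/-- A smaller set has coarser intervals: the start of an interval for `V'` is found from the start
of the interval for `V`. -/
theorem Recurrent.lastVisit_lastVisit (hV : Recurrent f V) (hV' : Recurrent f V') (h : V' ⊆ V)
    (x : X) : lastVisit f V' (lastVisit f V x) = lastVisit f V' x := by
  induction x using hV.back_induction with
  | mem x hx => rw [lastVisit_of_mem hx]
  | step x hx ih =>
    rw [hV.lastVisit_of_notMem hx, ih, hV'.lastVisit_of_notMem fun h' => hx (h h')]

theorem Recurrent.nextVisit_eq (hV : Recurrent f V) (hV' : Recurrent f V') (h : V' ⊆ V)
    {x : X} (hx : nextVisit f V x ∈ V') : nextVisit f V' x = nextVisit f V x := by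
  induction x using hV.fwd_induction with
  | mem x hx' =>
    rw [nextVisit_of_mem hx'] at hx ⊢
    rw [nextVisit_of_mem hx]
  | step x hx' ih =>
    rw [hV.nextVisit_of_notMem hx'] at hx ⊢
    rw [hV'.nextVisit_of_notMem fun h' => hx' (h h'), ih hx]

theorem Recurrent.lastVisit_nextVisit (hV : Recurrent f V) (hV' : Recurrent f V') (h : V' ⊆ V)
    {x : X} (hx : nextVisit f V x ∉ V') : lastVisit f V' (nextVisit f V x) = lastVisit f V' x := by
  induction x using hV.fwd_induction with
  | mem x hx' =>
    rw [nextVisit_of_mem hx'] at hx ⊢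
    rw [hV'.lastVisit_of_notMem hx]
  | step x hx' ih =>
    rw [hV.nextVisit_of_notMem hx'] at hx ⊢
    rw [ih hx, hV'.lastVisit_of_notMem fun h' => hx' (h h')]

/-- Here `y` is the last point of the interval of `x`. This recognises intervals that end at the
marked point. -/
theorem Recurrent.lastVisit_of_apply_eq_nextVisit (hV : Recurrent f V) {x y : X}
    (h : f y = nextVisit f V x) : lastVisit f V y = lastVisit f V x := by
  induction x using hV.fwd_induction with
  | mem x hx =>
    rw [nextVisit_of_mem hx] at h
    rw [f.injective h]
  | step x hx ih =>
    rw [hV.nextVisit_of_notMem hx] at h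
    rw [ih h, hV.lastVisit_of_notMem hx]

theorem isLocallyConstant_sInf {Y : Type*} [TopologicalSpace Y] {s : Y → Set ℕ}
    (hs : ∀ y, (s y).Nonempty) (hc : ∀ i, IsClopen {y | i ∈ s y}) :
    IsLocallyConstant fun y => sInf (s y) := by
  rw [IsLocallyConstant.iff_eventually_eq]
  intro y
  have h1 : ∀ᶠ z in 𝓝 y, sInf (s y) ∈ s z := (hc _).isOpen.mem_nhds (Nat.sInf_mem (hs y))
  have h2 : ∀ᶠ z in 𝓝 y, ∀ i ∈ Finset.range (sInf (s y)), i ∉ s z := by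
    rw [Filter.eventually_all_finset]
    intro i hi
    exact (hc i).compl.isOpen.mem_nhds (Nat.notMem_of_lt_sInf (Finset.mem_range.1 hi))
  filter_upwards [h1, h2] with z h1 h2
  refine le_antisymm (Nat.sInf_le h1) (not_lt.1 fun hlt => ?_)
  exact h2 _ (Finset.mem_range.2 hlt) (Nat.sInf_mem (hs z))

theorem Recurrent.isLocallyConstant_backTime (hV : Recurrent f V) (hc : IsClopen V) :
    IsLocallyConstant (backTime f V) :=
  isLocallyConstant_sInf hV.back fun _ => hc.preimage (Homeomorph.continuous _)

theorem Recurrent.isLocallyConstant_fwdTime (hV : Recurrent f V) (hc : IsClopen V) :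
    IsLocallyConstant (fwdTime f V) :=
  isLocallyConstant_sInf hV.fwd fun _ => hc.preimage (Homeomorph.continuous _)

theorem continuous_zpow_apply {Y : Type*} [TopologicalSpace Y] {k : Y → ℤ}
    (hk : IsLocallyConstant k) {g : Y → X} (hg : Continuous g) :
    Continuous fun y => (f ^ k y) (g y) := by
  rw [continuous_iff_continuousAt]
  intro y
  have : (fun z => (f ^ k y) (g z)) =ᶠ[𝓝 y] fun z => (f ^ k z) (g z) := by
    filter_upwards [(IsLocallyConstant.iff_eventually_eq k).1 hk y] with z hz
    rw [hz]
  exact ((Homeomorph.continuous _).comp hg).continuousAt.congr this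

theorem Recurrent.continuous_lastVisit (hV : Recurrent f V) (hc : IsClopen V) :
    Continuous (lastVisit f V) :=
  continuous_zpow_apply ((hV.isLocallyConstant_backTime hc).comp fun i : ℕ => -(i : ℤ))
    continuous_id

theorem Recurrent.continuous_nextVisit (hV : Recurrent f V) (hc : IsClopen V) :
    Continuous (nextVisit f V) :=
  continuous_zpow_apply ((hV.isLocallyConstant_fwdTime hc).comp fun i : ℕ => (i : ℤ) + 1)
    continuous_id

end Visits

/-! ### Refining interval partitions of the cut orbits -/

section Towers

variable {X : Type*} [TopologicalSpace X]

/-- A refining sequence of partitions of the `f`-orbits, cut between `p` and `f p`, into finite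
intervals. The intervals of level `n` that lie at an end of an interval of level `n + 1` are marked:
by `some false` at its beginning and by `some true` at its end. -/
structure Towers (f : X ≃ₜ X) (p : X) where
  rel : ℕ → Setoid X
  side : ℕ → X → Option Bool
  monotone_rel : Monotone rel
  side_eq : ∀ {n x y}, rel n x y → side n x = side n y
  isLocallyConstant_side : ∀ n, IsLocallyConstant (side n)
  isClopen_rel : ∀ n (k : ℤ), IsClopen {x | rel n x ((f ^ k) x)}
  finite_rel : ∀ n, {k : ℤ | ∃ x, rel n x ((f ^ k) x)}.Finite
  exists_zpow : ∀ {n x y}, rel n x y → ∃ k : ℤ, (f ^ k) x = y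
  exists_rel_apply : ∀ {x}, x ≠ p → ∃ n, rel n x (f x)
  not_rel : ∀ n, ¬ rel n p (f p)
  side_self : ∀ n, side n p = some true
  side_apply : ∀ n, side n (f p) = some false
  eq_of_side_true : ∀ {x}, (∀ n, side n x = some true) → x = p
  eq_of_side_false : ∀ {x}, (∀ n, side n x = some false) → x = f p
  rel_of_side : ∀ {x s N}, (∀ n ≥ N, side n x = some s) → rel N x (cond s p (f p))
  exists_side_ne : ∀ n x s, ∃ y, rel (n + 1) x y ∧ side n y ≠ some s
  exists_mem : ∀ {W : Set X}, IsOpen W → W.Nonempty → ∃ N, ∀ n ≥ N, ∀ x, ∃ y ∈ W, rel n x y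

namespace Towers

variable {f : X ≃ₜ X} {p : X} (A : Towers f p)

/-- The end of the half orbits of `p` and `f p`: `p` for `true`, `f p` for `false`. -/
def endpt (_ : Towers f p) (s : Bool) : X := cond s p (f p)

theorem side_endpt (s : Bool) (n : ℕ) : A.side n (A.endpt s) = some s := by
  cases s
  · exact A.side_apply n
  · exact A.side_self n

theorem eq_endpt {x : X} {s : Bool} (h : ∀ n, A.side n x = some s) : x = A.endpt s := by
  cases s
  · exact A.eq_of_side_false h
  · exact A.eq_of_side_true h

theorem exists_side_ne_of_ne {x : X} {s : Bool} (h : x ≠ A.endpt s) :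
    ∃ n, A.side n x ≠ some s := by
  by_contra! h'
  exact h (A.eq_endpt h')

theorem rel_endpt {x : X} {s : Bool} {N : ℕ} (h : ∀ n ≥ N, A.side n x = some s) :
    A.rel N x (A.endpt s) :=
  A.rel_of_side h

theorem rel_mono {m n : ℕ} (h : m ≤ n) {x y : X} (hxy : A.rel m x y) : A.rel n x y :=
  A.monotone_rel h hxy

/-- Going backwards from `p`, or forwards from `f p`, never crosses the cut, because by freeness the
orbit does not return to `p`. -/
theorem exists_rel_iterate (hfree : ∀ k : ℤ, k ≠ 0 → ∀ x, (f ^ k) x ≠ x) (s : Bool) (k : ℕ) :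
    ∃ n, A.rel n (A.endpt s) ((f ^ (cond s (-(k : ℤ)) k)) (A.endpt s)) := by
  have step : ∀ x y : X, f x = y → x ≠ p → ∃ n, A.rel n x y := by
    rintro x _ rfl hx
    exact A.exists_rel_apply hx
  induction k with
  | zero =>
    refine ⟨0, ?_⟩
    have : (cond s (-((0 : ℕ) : ℤ)) ((0 : ℕ) : ℤ)) = 0 := by cases s <;> rfl
    rw [this, zpow_zero, Homeomorph.one_apply]
  | succ k ih =>
    obtain ⟨n, hn⟩ := ih
    cases s with
    | true =>
      obtain ⟨m, hm⟩ := step ((f ^ (-((k + 1 : ℕ) : ℤ))) p) ((f ^ (-(k : ℤ))) p)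
        (by rw [← zpow_apply_comm, ← zpow_succ_apply]; congr 2; push_cast; ring)
        (hfree _ (by omega) _)
      exact ⟨max n m, (A.rel _).trans (A.rel_mono (le_max_left n m) hn)
        ((A.rel _).symm (A.rel_mono (le_max_right n m) hm))⟩
    | false =>
      obtain ⟨m, hm⟩ := step ((f ^ (k : ℤ)) (f p)) ((f ^ ((k + 1 : ℕ) : ℤ)) (f p))
        (by rw [← zpow_apply_comm, ← zpow_succ_apply]; rfl)
        (by rw [← zpow_succ_apply]; exact hfree _ (by omega) _)
      exact ⟨max n m, (A.rel _).trans (A.rel_mono (le_max_left n m) hn)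
        (A.rel_mono (le_max_right n m) hm)⟩

end Towers

end Towers

/-! ### Construction of the towers from minimality and freeness -/

section TowersExist

variable {X : Type*} [TopologicalSpace X]

theorem exists_zpow_mem [CompactSpace X] {f : X ≃ₜ X}
    (hmin : ∀ x, Dense {y | ∃ k : ℤ, (f ^ k) x = y}) {V : Set X} (hV : IsOpen V)
    (hne : V.Nonempty) : ∃ M : ℕ, ∀ x, ∃ k : ℤ, |k| ≤ M ∧ (f ^ k) x ∈ V := by
  obtain ⟨F, hF⟩ := isCompact_univ.elim_finite_subcover (fun k : ℤ => (f ^ k) ⁻¹' V)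
    (fun k => hV.preimage (Homeomorph.continuous _)) (by
      intro x _
      obtain ⟨y, hy, k, hk⟩ := (hmin x).inter_open_nonempty V hV hne
      exact mem_iUnion.2 ⟨k, by rwa [mem_preimage, hk]⟩)
  refine ⟨F.sup Int.natAbs, fun x => ?_⟩
  obtain ⟨k, hk, hx⟩ := mem_iUnion₂.1 (hF (mem_univ x))
  refine ⟨k, ?_, hx⟩
  rw [Int.abs_eq_natAbs]
  exact_mod_cast Finset.le_sup (f := Int.natAbs) hk

/-- Compactness bounds hitting times uniformly, so a shift of the starting point fixes their sign.
-/
theorem recurrent_of_minimal [CompactSpace X] {f : X ≃ₜ X}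
    (hmin : ∀ x, Dense {y | ∃ k : ℤ, (f ^ k) x = y}) {V : Set X} (hV : IsOpen V)
    (hne : V.Nonempty) : Recurrent f V := by
  obtain ⟨M, hM⟩ := exists_zpow_mem hmin hV hne
  constructor
  · intro x
    obtain ⟨k, hk, hx⟩ := hM ((f ^ (-(M : ℤ))) x)
    rw [abs_le] at hk
    refine ⟨(M - k).toNat, ?_⟩
    rw [← zpow_add_apply] at hx
    convert hx using 3
    omega
  · intro x
    obtain ⟨k, hk, hx⟩ := hM ((f ^ (M + 1 : ℤ)) x)
    rw [abs_le] at hk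
    refine ⟨(M + k).toNat, ?_⟩
    rw [← zpow_add_apply] at hx
    convert hx using 3
    omega

theorem exists_nhds_wandering [T2Space X] {f : X ≃ₜ X} {z : X}
    (hfree : ∀ k : ℤ, k ≠ 0 → ∀ x, (f ^ k) x ≠ x) (M : ℕ) :
    ∃ O ∈ 𝓝 z, ∀ j : ℕ, j < M → ∀ y ∈ O, (f ^ ((j : ℤ) + 1)) y ∉ O := by
  induction M with
  | zero => exact ⟨univ, Filter.univ_mem, by simp⟩
  | succ M ih =>
    obtain ⟨O, hO, h⟩ := ih
    obtain ⟨A, C, hA, hC, hzA, hzC, hAC⟩ := t2_separation (hfree ((M : ℤ) + 1) (by omega) z)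
    refine ⟨O ∩ (C ∩ (f ^ ((M : ℤ) + 1)) ⁻¹' A), Filter.inter_mem hO (Filter.inter_mem
      (hC.mem_nhds hzC) ((hA.preimage (Homeomorph.continuous _)).mem_nhds hzA)), ?_⟩
    intro j hj y hy hfy
    rcases Nat.lt_succ_iff_lt_or_eq.1 hj with hj | rfl
    · exact h j hj y hy.1 hfy.1
    · exact disjoint_left.1 hAC hy.2.2 hfy.2.1

/-- Return times to `V` are bounded, so a neighbourhood of `z` without returns up to that bound
cannot be met at the next visit to `V`. Each interval for `V'` therefore contains at least two
intervals for `V`. -/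
theorem exists_isClopen_nextVisit_notMem [CompactSpace X] [T2Space X] [TotallyDisconnectedSpace X]
    {f : X ≃ₜ X} {z : X} (hfree : ∀ k : ℤ, k ≠ 0 → ∀ x, (f ^ k) x ≠ x)
    (hmin : ∀ x, Dense {y | ∃ k : ℤ, (f ^ k) x = y}) {V W : Set X} (hV : IsClopen V)
    (hz : z ∈ V) (hW : W ∈ 𝓝 z) :
    ∃ V', IsClopen V' ∧ z ∈ V' ∧ V' ⊆ V ∩ W ∧ ∀ x ∈ V', nextVisit f V x ∉ V' := by
  have hr := recurrent_of_minimal hmin hV.isOpen ⟨z, hz⟩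
  obtain ⟨M, hM⟩ := (hr.isLocallyConstant_fwdTime hV).range_finite.bddAbove
  -- `fwdTime` is one less than the return time, so `fwdTime ≤ M` allows up to `M + 1` steps.
  obtain ⟨O, hO, hOw⟩ := exists_nhds_wandering (z := z) hfree (M + 1)
  obtain ⟨A, hAs, hA, hzA⟩ :=
    mem_nhds_iff.1 (Filter.inter_mem hO (Filter.inter_mem (hV.isOpen.mem_nhds hz) hW))
  obtain ⟨V', hV', hzV', hV'A⟩ := compact_exists_isClopen_in_isOpen hA hzA
  refine ⟨V', hV', hzV', fun x hx => (hAs (hV'A hx)).2, fun x hx hn => ?_⟩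
  exact hOw _ (Nat.lt_succ_of_le (hM ⟨x, rfl⟩)) x (hAs (hV'A hx)).1 (hAs (hV'A hn)).1

theorem exists_clopen_sequence [CompactSpace X] [T2Space X] [TotallyDisconnectedSpace X]
    [FirstCountableTopology X]
    {f : X ≃ₜ X} (z : X) (hfree : ∀ k : ℤ, k ≠ 0 → ∀ x, (f ^ k) x ≠ x)
    (hmin : ∀ x, Dense {y | ∃ k : ℤ, (f ^ k) x = y}) :
    ∃ V : ℕ → Set X, V 0 = univ ∧ Antitone V ∧ (∀ n, IsClopen (V n)) ∧ (∀ n, z ∈ V n) ∧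
      (∀ O ∈ 𝓝 z, ∃ N, V N ⊆ O) ∧ ∀ n, ∀ x ∈ V (n + 1), nextVisit f (V n) x ∉ V (n + 1) := by
  obtain ⟨W, hW⟩ := (𝓝 z).exists_antitone_basis
  choose! next h1 h2 h3 h4 using fun (V : Set X) (n : ℕ) (h : IsClopen V ∧ z ∈ V) =>
    exists_isClopen_nextVisit_notMem hfree hmin h.1 h.2 (hW.mem n)
  let V : ℕ → Set X := fun n => Nat.rec univ (fun n V => next V n) n
  have hV : ∀ n, IsClopen (V n) ∧ z ∈ V n := by
    intro n
    induction n with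
    | zero => exact ⟨isClopen_univ, mem_univ z⟩
    | succ n ih => exact ⟨h1 _ n ih, h2 _ n ih⟩
  refine ⟨V, rfl, antitone_nat_of_succ_le fun n => (h3 _ n (hV n)).trans inter_subset_left,
    fun n => (hV n).1, fun n => (hV n).2, fun O hO => ?_, fun n => h4 _ n (hV n)⟩
  obtain ⟨n, hn⟩ := hW.mem_iff.1 hO
  exact ⟨n + 1, ((h3 _ n (hV n)).trans inter_subset_right).trans hn⟩

/-- The base sets shrink to `f p`, so every level starts a new interval at `f p` and ends one at
`p`. An interval that is initial at all levels from some level on has a fixed start lying in all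
bases, which is `f p`; final intervals are treated in the same way. -/
theorem exists_towers [CompactSpace X] [T2Space X] [TotallyDisconnectedSpace X]
    [FirstCountableTopology X]
    {f : X ≃ₜ X} (p : X) (hfree : ∀ k : ℤ, k ≠ 0 → ∀ x, (f ^ k) x ≠ x)
    (hmin : ∀ x, Dense {y | ∃ k : ℤ, (f ^ k) x = y}) : Nonempty (Towers f p) := by
  obtain ⟨V, hV0, hanti, hcl, hz, hsmall, hgap⟩ := exists_clopen_sequence (f p) hfree hmin
  have hr : ∀ n, Recurrent f (V n) := fun n =>
    recurrent_of_minimal hmin (hcl n).isOpen ⟨_, hz n⟩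
  have hlast : ∀ n x, lastVisit f (V n) x ∈ V n := fun n x => (hr n).lastVisit_mem x
  have hsub : ∀ n, V (n + 1) ⊆ V n := fun n => hanti n.le_succ
  have hinj : ∀ x (k l : ℤ), (f ^ k) x = (f ^ l) x → k = l := by
    intro x k l h
    by_contra hne
    apply hfree (k - l) (sub_ne_zero.2 hne) ((f ^ l) x)
    rw [← zpow_add_apply, sub_add_cancel, h]
  have hinter : ∀ {x N}, (∀ n ≥ N, x ∈ V n) → x = f p := by
    intro x N hx
    by_contra hne
    obtain ⟨M, hM⟩ := hsmall {x}ᶜ (isOpen_compl_singleton.mem_nhds (Ne.symm hne))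
    exact hM (hanti (le_max_right N M) (hx _ (le_max_left N M))) rfl
  have hstart : ∀ {x N}, (∀ n ≥ N, lastVisit f (V n) x ∈ V (n + 1)) →
      lastVisit f (V N) x = f p := by
    intro x N h
    have hc : ∀ n ≥ N, lastVisit f (V n) x = lastVisit f (V N) x := by
      intro n hn
      induction n, hn using Nat.le_induction with
      | base => rfl
      | succ n hn ih =>
        rw [← ih, ← (hr n).lastVisit_lastVisit (hr (n + 1)) (hsub n), lastVisit_of_mem (h n hn)]
    exact hinter (N := N) fun n hn => hc n hn ▸ hlast n x
  have hend : ∀ {x N}, (∀ n ≥ N, nextVisit f (V n) x ∈ V (n + 1)) →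
      nextVisit f (V N) x = f p := by
    intro x N h
    have hc : ∀ n ≥ N, nextVisit f (V n) x = nextVisit f (V N) x := by
      intro n hn
      induction n, hn using Nat.le_induction with
      | base => rfl
      | succ n hn ih => rw [← ih, (hr n).nextVisit_eq (hr (n + 1)) (hsub n) (h n hn)]
    exact hinter (N := N) fun n hn => hc n hn ▸ (hr n).nextVisit_mem x
  -- No interval is both first and last in the next one, so the order of the tests in `side` does
  -- not matter.
  have hend' : ∀ {n x}, lastVisit f (V n) x ∈ V (n + 1) → nextVisit f (V n) x ∉ V (n + 1) := by
    intro n x h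
    rw [← (hr n).nextVisit_lastVisit]
    exact hgap n _ h
  classical
  let side : ℕ → X → Option Bool := fun n x =>
    if lastVisit f (V n) x ∈ V (n + 1) then some false
    else if nextVisit f (V n) x ∈ V (n + 1) then some true else none
  have side_false : ∀ {n x}, side n x = some false ↔ lastVisit f (V n) x ∈ V (n + 1) := by
    intro n x; simp only [side]
    split_ifs with h1 h2
    · exact iff_of_true rfl h1
    · exact iff_of_false (by decide) h1
    · exact iff_of_false (by decide) h1
  have side_true : ∀ {n x}, side n x = some true ↔ nextVisit f (V n) x ∈ V (n + 1) := by
    intro n x; simp only [side]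
    split_ifs with h1 h2
    · exact iff_of_false (by decide) (hend' h1)
    · exact iff_of_true rfl h2
    · exact iff_of_false (by decide) h2
  -- The relation becomes a condition on locally constant integers with finite range, which gives
  -- both the clopen slices and the finiteness in `k`.
  have hrel : ∀ n (k : ℤ) x, lastVisit f (V n) x = lastVisit f (V n) ((f ^ k) x) ↔
      (backTime f (V n) ((f ^ k) x) : ℤ) - backTime f (V n) x = k := by
    intro n k x
    rw [lastVisit, lastVisit, ← zpow_add_apply]
    constructor
    · intro h
      have := hinj _ _ _ h
      omega
    · intro h
      congr 2; omega
  have hbt : ∀ n, IsLocallyConstant (backTime f (V n)) := fun n =>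
    (hr n).isLocallyConstant_backTime (hcl n)
  refine ⟨{
    rel := fun n => Setoid.ker (lastVisit f (V n))
    side := side
    monotone_rel := ?_, side_eq := ?_, isLocallyConstant_side := ?_, isClopen_rel := ?_
    finite_rel := ?_, exists_zpow := ?_, exists_rel_apply := ?_, not_rel := ?_, side_self := ?_
    side_apply := ?_, eq_of_side_true := ?_, eq_of_side_false := ?_, rel_of_side := ?_
    exists_side_ne := ?_, exists_mem := ?_ }⟩
  · refine monotone_nat_of_le_succ fun n x y h => ?_
    change lastVisit f _ x = lastVisit f _ y at h
    change lastVisit f _ x = lastVisit f _ y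
    rw [← (hr n).lastVisit_lastVisit (hr (n + 1)) (hsub n) x, h,
      (hr n).lastVisit_lastVisit (hr (n + 1)) (hsub n) y]
  · intro n x y h
    change lastVisit f _ x = lastVisit f _ y at h
    have : nextVisit f (V n) x = nextVisit f (V n) y := by
      rw [← (hr n).nextVisit_lastVisit, h, (hr n).nextVisit_lastVisit]
    simp only [side, h, this]
  · intro n
    have h1 := (hcl (n + 1)).preimage ((hr n).continuous_lastVisit (hcl n))
    have h2 := (hcl (n + 1)).preimage ((hr n).continuous_nextVisit (hcl n))
    rw [IsLocallyConstant.iff_eventually_eq]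
    intro x
    have e1 : ∀ᶠ y in 𝓝 x,
        (lastVisit f (V n) y ∈ V (n + 1) ↔ lastVisit f (V n) x ∈ V (n + 1)) := by
      by_cases hx : lastVisit f (V n) x ∈ V (n + 1)
      · filter_upwards [h1.isOpen.mem_nhds hx] with y hy using iff_of_true hy hx
      · filter_upwards [h1.compl.isOpen.mem_nhds hx] with y hy using iff_of_false hy hx
    have e2 : ∀ᶠ y in 𝓝 x,
        (nextVisit f (V n) y ∈ V (n + 1) ↔ nextVisit f (V n) x ∈ V (n + 1)) := by
      by_cases hx : nextVisit f (V n) x ∈ V (n + 1)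
      · filter_upwards [h2.isOpen.mem_nhds hx] with y hy using iff_of_true hy hx
      · filter_upwards [h2.compl.isOpen.mem_nhds hx] with y hy using iff_of_false hy hx
    filter_upwards [e1, e2] with y hy1 hy2
    simp only [side, hy1, hy2]
  · intro n k
    have : IsLocallyConstant fun x =>
        (backTime f (V n) ((f ^ k) x) : ℤ) - backTime f (V n) x :=
      (((hbt n).comp_continuous (Homeomorph.continuous (f ^ k))).comp fun i : ℕ => (i : ℤ)).sub
        ((hbt n).comp fun i : ℕ => (i : ℤ))
    convert this.isClopen_fiber k using 1
    ext x
    exact hrel n k x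
  · intro n
    have hf := (hbt n).range_finite
    refine ((hf.prod hf).image fun a : ℕ × ℕ => (a.1 : ℤ) - a.2).subset ?_
    rintro k ⟨x, hx⟩
    exact ⟨(_, _), ⟨⟨_, rfl⟩, ⟨_, rfl⟩⟩, (hrel n k x).1 hx⟩
  · intro n x y h
    change lastVisit f _ x = lastVisit f _ y at h
    refine ⟨(backTime f (V n) y : ℤ) + (-(backTime f (V n) x : ℤ)), ?_⟩
    rw [zpow_add_apply]
    change (f ^ _) (lastVisit f _ x) = _
    rw [h, lastVisit, ← zpow_add_apply, add_neg_cancel, zpow_zero, Homeomorph.one_apply]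
  · intro x hx
    obtain ⟨n, hn⟩ := hsmall {f x}ᶜ
      (isOpen_compl_singleton.mem_nhds fun h => hx (f.injective h.symm))
    exact ⟨n, ((hr n).lastVisit_of_notMem fun h => hn h rfl).symm⟩
  · intro n h
    change lastVisit f _ _ = lastVisit f _ _ at h
    rw [lastVisit_of_mem (hz n), lastVisit] at h
    have := hinj p (-(backTime f (V n) p : ℤ)) 1 (by rw [h, zpow_one])
    omega
  · intro n
    rw [side_true, nextVisit_of_mem (hz n)]
    exact hz _
  · intro n
    rw [side_false, lastVisit_of_mem (hz n)]
    exact hz _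
  · intro x h
    -- Since `V 0` is the whole space, intervals of level 0 are single points.
    have := hend (N := 0) fun n _ => side_true.1 (h n)
    rw [nextVisit_of_mem (hV0 ▸ mem_univ _)] at this
    exact f.injective this
  · intro x h
    have := hstart (N := 0) fun n _ => side_false.1 (h n)
    rwa [lastVisit_of_mem (hV0 ▸ mem_univ _)] at this
  · intro x s N h
    cases s with
    | false =>
      change lastVisit f _ x = lastVisit f _ (f p)
      rw [hstart (N := N) fun n hn => side_false.1 (h n hn), lastVisit_of_mem (hz N)]
    | true =>
      exact ((hr N).lastVisit_of_apply_eq_nextVisit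
        (hend (N := N) fun n hn => side_true.1 (h n hn)).symm).symm
  · intro n x s
    -- The first subinterval is not last, and the second one exists by `hgap` and is not first.
    have hmem := hlast (n + 1) x
    cases s with
    | true =>
      refine ⟨lastVisit f (V (n + 1)) x, (lastVisit_of_mem hmem).symm, ?_⟩
      rw [side_false.2]
      · simp
      · rwa [lastVisit_of_mem (hsub n hmem)]
    | false =>
      have hn := hgap n _ hmem
      refine ⟨nextVisit f (V n) (lastVisit f (V (n + 1)) x), ?_, ?_⟩
      · change lastVisit f _ _ = lastVisit f _ _
        rw [(hr n).lastVisit_nextVisit (hr (n + 1)) (hsub n) hn, lastVisit_of_mem hmem]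
      · rw [Ne, side_false, lastVisit_of_mem ((hr n).nextVisit_mem _)]
        exact hn
  · intro W hW hne
    obtain ⟨i, hi⟩ := (recurrent_of_minimal hmin hW hne).fwd (f p)
    -- Once the base lies in a set without returns for `i + 1` steps, each interval still contains
    -- the point `i + 1` steps after its start, and that point lies in `W`.
    obtain ⟨O, hO, hOw⟩ := exists_nhds_wandering (z := f p) hfree (i + 1)
    obtain ⟨N, hN⟩ := hsmall _ (Filter.inter_mem hO
      ((hW.preimage (Homeomorph.continuous (f ^ ((i : ℤ) + 1)))).mem_nhds hi))
    refine ⟨N, fun n hn x => ?_⟩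
    have hO' : V n ⊆ _ := (hanti hn).trans hN
    have hmem := hlast n x
    refine ⟨_, (hO' hmem).2, ?_⟩
    change lastVisit f _ _ = lastVisit f _ _
    have : ∀ j : ℕ, j ≤ i + 1 →
        lastVisit f (V n) ((f ^ (j : ℤ)) (lastVisit f (V n) x)) = lastVisit f (V n) x := by
      intro j
      induction j with
      | zero =>
        intro _
        rw [Nat.cast_zero, zpow_zero, Homeomorph.one_apply, lastVisit_of_mem hmem]
      | succ j ih =>
        intro hj
        have := hOw j (by omega) _ (hO' hmem).1
        rw [← ih (by omega), Nat.cast_succ, zpow_succ_apply, zpow_apply_comm, ih (by omega)]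
        rw [zpow_succ_apply, zpow_apply_comm] at this
        rw [(hr n).lastVisit_of_notMem fun h => this (hO' h).1, ih (by omega)]
    exact_mod_cast (this (i + 1) le_rfl).symm

end TowersExist

/-! ### Subrelations of a free orbit relation as subsets of space times group -/

section Chart

variable {X G : Type*} [TopologicalSpace X] [Group G]

/-- The action `φ` is free. -/
def IsFreeAction (φ : G →* (X ≃ₜ X)) : Prop := ∀ g, g ≠ 1 → ∀ x, φ g x ≠ x

theorem IsFreeAction.eq_of_apply_eq {φ : G →* (X ≃ₜ X)} (hφ : IsFreeAction φ) {g k : G} {x : X}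
    (h : φ g x = φ k x) : g = k := by
  by_contra hne
  refine hφ (k⁻¹ * g) (fun h' => hne (inv_mul_eq_one.1 h').symm) x ?_
  rw [map_mul, Homeomorph.mul_apply, h, ← Homeomorph.mul_apply, ← map_mul, inv_mul_cancel, map_one,
    Homeomorph.one_apply]

namespace RelGraph

variable {Y : Type*} {S : Setoid Y} {φ : G →* (X ≃ₜ X)} {ι : Y → X}

/-- The group element that carries `ι x` to `ι y`, for `(x, y)` in a relation that `ι` maps into
`R_φ`. -/
noncomputable def cocycle (h : ∀ x y, S x y → orbitRel φ (ι x) (ι y)) (q : RelGraph S) : G :=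
  (h _ _ q.rel).choose

theorem cocycle_spec (h : ∀ x y, S x y → orbitRel φ (ι x) (ι y)) (q : RelGraph S) :
    φ (cocycle h q) (ι q.fst) = ι q.snd :=
  (h _ _ q.rel).choose_spec

theorem cocycle_eq (hφ : IsFreeAction φ) (h : ∀ x y, S x y → orbitRel φ (ι x) (ι y))
    {q : RelGraph S} {g : G} (hg : φ g (ι q.fst) = ι q.snd) : cocycle h q = g :=
  hφ.eq_of_apply_eq ((cocycle_spec h q).trans hg.symm)

/-- The map `(x, y) ↦ (x, g)`, where `g` carries `ι x` to `ι y`. -/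
noncomputable def chart (h : ∀ x y, S x y → orbitRel φ (ι x) (ι y)) (q : RelGraph S) : Y × G :=
  (q.fst, cocycle h q)

theorem chart_injective (hι : Function.Injective ι)
    (h : ∀ x y, S x y → orbitRel φ (ι x) (ι y)) : Function.Injective (chart h) := by
  intro q r hqr
  have h1 : q.fst = r.fst := congrArg Prod.fst hqr
  have h2 : cocycle h q = cocycle h r := congrArg Prod.snd hqr
  refine RelGraph.ext h1 (hι ?_)
  rw [← cocycle_spec h q, ← cocycle_spec h r, h1, h2]

theorem mem_range_chart (hφ : IsFreeAction φ) (h : ∀ x y, S x y → orbitRel φ (ι x) (ι y))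
    {a : Y × G} : a ∈ range (chart h) ↔ ∃ y, S a.1 y ∧ φ a.2 (ι a.1) = ι y := by
  constructor
  · rintro ⟨q, rfl⟩
    exact ⟨q.snd, q.rel, cocycle_spec h q⟩
  · rintro ⟨y, hy, hg⟩
    exact ⟨⟨a.1, y, hy⟩, Prod.ext rfl (cocycle_eq hφ h hg)⟩

end RelGraph

open RelGraph

variable [TopologicalSpace G] {φ : G →* (X ≃ₜ X)}

/-- If `b` preserves the group element of each pair, then in the charts the induced map is `b` times
the identity. -/
theorem inducesIso_of_cocycle_eq {Y Y' : Type*} [TopologicalSpace Y] [TopologicalSpace Y']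
    (hφ : IsFreeAction φ) {ι : Y → X} {ι' : Y' → X} {S : Setoid Y} {S' : Setoid Y'}
    (h : ∀ x y, S x y → orbitRel φ (ι x) (ι y)) (h' : ∀ x y, S' x y → orbitRel φ (ι' x) (ι' y))
    {T : TopologicalSpace (RelGraph S)} {T' : TopologicalSpace (RelGraph S')}
    (hT : T = TopologicalSpace.induced (chart h) inferInstance)
    (hT' : T' = TopologicalSpace.induced (chart h') inferInstance) (hι' : Function.Injective ι')
    {b : Y → Y'} (hb : IsHomeomorph b) (hiff : ∀ x y, S x y ↔ S' (b x) (b y))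
    (hco : ∀ x y g, S x y → φ g (ι x) = ι y → φ g (ι' (b x)) = ι' (b y)) :
    InducesIso S T S' T' b := by
  refine ⟨hb, hiff, ?_⟩
  have hi : IsInducing (chart h) := ⟨hT⟩
  have he' : IsEmbedding (chart h') := ⟨⟨hT'⟩, chart_injective hι' h'⟩
  have hcomp : chart h' ∘ RelGraph.map b (fun x y => (hiff x y).1) = Prod.map b id ∘ chart h := by
    ext q
    · rfl
    · exact cocycle_eq hφ h' (hco _ _ _ q.rel (cocycle_spec h q))
  have hind : IsInducing (RelGraph.map b fun x y => (hiff x y).1 : RelGraph S → RelGraph S') := by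
    rw [← he'.isInducing.of_comp_iff, hcomp]
    exact (hb.isInducing.prodMap IsInducing.id).comp hi
  rw [isHomeomorph_iff_isEmbedding_surjective]
  refine ⟨⟨hind, fun q r hqr => ?_⟩, fun q => ?_⟩
  · exact RelGraph.ext (hb.injective (congrArg RelGraph.fst hqr))
      (hb.injective (congrArg RelGraph.snd hqr))
  · obtain ⟨x, hx⟩ := hb.surjective q.fst
    obtain ⟨y, hy⟩ := hb.surjective q.snd
    exact ⟨⟨x, y, (hiff x y).2 (by rw [hx, hy]; exact q.rel)⟩, RelGraph.ext hx hy⟩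

variable [DiscreteTopology G]

/-- By freeness the chart is the inverse of the map defining the topology. Induced topologies then
compose with every restriction. -/
theorem orbitTopology_eq_induced (hφ : IsFreeAction φ) {h : ∀ x y, orbitRel φ x y → orbitRel φ x y} :
    orbitTopology φ = TopologicalSpace.induced (chart (ι := id) h) inferInstance := by
  have hG := DiscreteTopology.eq_bot (α := G)
  subst hG
  let e : RelGraph (orbitRel φ) ≃ X × G :=
    { toFun := chart (ι := id) h
      invFun := fun q => ⟨q.1, φ q.2 q.1, ⟨q.2, rfl⟩⟩
      left_inv := fun q => RelGraph.ext rfl (cocycle_spec (ι := id) h q)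
      right_inv := fun a => Prod.ext rfl (cocycle_eq (ι := id) hφ h rfl) }
  exact congrFun e.coinduced_symm _

theorem subTopology_eq_induced (hφ : IsFreeAction φ) {R : Setoid X} (hR : R ≤ orbitRel φ) :
    subTopology hR (orbitTopology φ) =
      TopologicalSpace.induced (chart (ι := id) fun _ _ h => hR h) inferInstance := by
  rw [subTopology, orbitTopology_eq_induced hφ (h := fun _ _ h => h), induced_compose]
  rfl

theorem restrictTopology_eq_induced (hφ : IsFreeAction φ) {R : Setoid X} (hR : R ≤ orbitRel φ)
    (B : Set X) :
    restrictTopology (subTopology hR (orbitTopology φ)) B =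
      TopologicalSpace.induced (chart (S := restrictRel R B) (ι := Subtype.val) fun _ _ h => hR h)
        inferInstance := by
  have hi : IsInducing (Prod.map Subtype.val id : B × G → X × G) :=
    IsInducing.subtypeVal.prodMap IsInducing.id
  rw [restrictTopology, subTopology_eq_induced hφ, hi.eq_induced, induced_compose, induced_compose]
  rfl

theorem isOpen_of_slices {Y H : Type*} [TopologicalSpace Y] [TopologicalSpace H]
    [DiscreteTopology H] {s : Set (Y × H)}
    (hs : ∀ g, IsOpen {y | (y, g) ∈ s}) : IsOpen s := by
  have : s = ⋃ g, {y | (y, g) ∈ s} ×ˢ {g} := by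
    ext ⟨y, g⟩
    simp
  rw [this]
  exact isOpen_iUnion fun g => (hs g).prod (isOpen_discrete _)

theorem isLocalHomeomorph_fst {Y H : Type*} [TopologicalSpace Y] [TopologicalSpace H]
    [DiscreteTopology H] :
    IsLocalHomeomorph (Prod.fst : Y × H → Y) := by
  rw [isLocalHomeomorph_iff_isOpenEmbedding_restrict]
  intro a
  refine ⟨univ ×ˢ {a.2}, (isOpen_univ.prod (isOpen_discrete _)).mem_nhds ⟨mem_univ _, rfl⟩, ?_⟩
  refine .of_continuous_injective_isOpenMap (continuous_fst.comp continuous_subtype_val) ?_ ?_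
  · intro ⟨x, _, hx⟩ ⟨y, _, hy⟩ h
    exact Subtype.ext (Prod.ext h (hx.trans hy.symm))
  · exact isOpenMap_fst.comp (isOpen_univ.prod (isOpen_discrete _)).isOpenMap_subtype_val

theorem continuous_action_apply {Z : Type*} [TopologicalSpace Z] {g : Z → G} {k : Z → X}
    (hg : Continuous g) (hk : Continuous k) : Continuous fun z => φ (g z) (k z) := by
  have : Continuous fun a : X × G => φ a.2 a.1 := by
    refine ⟨fun U hU => isOpen_of_slices fun g => hU.preimage (Homeomorph.continuous (φ g))⟩
  exact this.comp (hk.prodMk hg)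

/-- Open slices make the chart an open embedding into `Y × G`, which supplies the topological
properties and the local homeomorphism. The groupoid operations become inversion and multiplication
in the discrete group. -/
theorem isEtale_of_isOpen {Y : Type*} [TopologicalSpace Y] [LocallyCompactSpace Y] [T2Space Y]
    [SecondCountableTopology Y] [Countable G] (hφ : IsFreeAction φ) {ι : Y → X}
    (hι : IsEmbedding ι) {S : Setoid Y} (h : ∀ x y, S x y → orbitRel φ (ι x) (ι y))
    (ho : ∀ g, IsOpen {x | ∃ y, S x y ∧ φ g (ι x) = ι y}) {T : TopologicalSpace (RelGraph S)}
    (hT : T = TopologicalSpace.induced (chart h) inferInstance) : IsEtale S T := by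
  have hi : IsInducing (chart h) := ⟨hT⟩
  have he : IsOpenEmbedding (chart h) := by
    refine ⟨⟨hi, chart_injective hι.injective h⟩, isOpen_of_slices fun g => ?_⟩
    simpa only [mem_range_chart hφ] using ho g
  have hfst : Continuous (RelGraph.fst : RelGraph S → Y) := continuous_fst.comp hi.continuous
  have hcoc : Continuous (cocycle h) := continuous_snd.comp hi.continuous
  have hsnd : Continuous (RelGraph.snd : RelGraph S → Y) := by
    rw [hι.continuous_iff]
    refine (continuous_action_apply (φ := φ) hcoc (hι.continuous.comp hfst)).congr fun q => ?_
    exact cocycle_spec h q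
  refine ⟨he.isEmbedding.t2Space, he.locallyCompactSpace, he.isEmbedding.secondCountableTopology,
    ?_, ?_, isLocalHomeomorph_fst.comp he.isLocalHomeomorph⟩
  · rw [hi.continuous_iff]
    refine (hsnd.prodMk (continuous_of_discreteTopology.comp hcoc :
      Continuous ((fun g : G => g⁻¹) ∘ cocycle h))).congr fun q => Prod.ext rfl ?_
    refine (cocycle_eq hφ h ?_).symm
    change φ (cocycle h q)⁻¹ (ι q.snd) = ι q.fst
    rw [← cocycle_spec h q, ← Homeomorph.mul_apply, ← map_mul, inv_mul_cancel, map_one,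
      Homeomorph.one_apply]
  · rw [hi.continuous_iff]
    have h1 : Continuous fun q : {q : RelGraph S × RelGraph S // q.1.snd = q.2.fst} => q.1.1 :=
      continuous_fst.comp continuous_subtype_val
    have h2 : Continuous fun q : {q : RelGraph S × RelGraph S // q.1.snd = q.2.fst} => q.1.2 :=
      continuous_snd.comp continuous_subtype_val
    refine ((hfst.comp h1).prodMk ((continuous_of_discreteTopology (f := fun a : G × G =>
      a.1 * a.2)).comp ((hcoc.comp h2).prodMk (hcoc.comp h1)))).congr fun q => Prod.ext rfl ?_
    refine (cocycle_eq hφ h ?_).symm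
    change φ (cocycle h q.1.2 * cocycle h q.1.1) (ι q.1.1.fst) = ι q.1.2.snd
    rw [map_mul, Homeomorph.mul_apply, cocycle_spec, q.2, cocycle_spec]

/-- In the chart `K` is a finite union of clopen slices. -/
theorem isCompact_and_isOpen_of_isClopen [CompactSpace X] (hφ : IsFreeAction φ) {R K : Setoid X}
    (hR : R ≤ orbitRel φ) (hK : K ≤ R) (hc : ∀ g, IsClopen {x | K x (φ g x)})
    (hf : {g | ∃ x, K x (φ g x)}.Finite) {T : TopologicalSpace (RelGraph R)}
    (hT : T = TopologicalSpace.induced (chart (ι := id) fun _ _ h => hR h) inferInstance) :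
    IsCompact {q : RelGraph R | K q.fst q.snd} ∧ IsOpen {q : RelGraph R | K q.fst q.snd} := by
  have hi : IsInducing (chart (S := R) (ι := id) fun _ _ h => hR h) := ⟨hT⟩
  have hspec := cocycle_spec (S := R) (ι := id) fun _ _ h => hR h
  simp only [id] at hspec
  have hpre : {q : RelGraph R | K q.fst q.snd} =
      chart (ι := id) (fun _ _ h => hR h) ⁻¹' {a : X × G | K a.1 (φ a.2 a.1)} := by
    ext q
    rw [mem_preimage, mem_ofPred_eq, mem_ofPred_eq]
    change _ ↔ K q.fst (φ (cocycle (ι := id) (fun _ _ h => hR h) q) q.fst)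
    rw [hspec]
  refine ⟨?_, ?_⟩
  · rw [hi.isCompact_iff]
    have himg : chart (ι := id) (fun _ _ h => hR h) '' {q : RelGraph R | K q.fst q.snd} =
        {a : X × G | K a.1 (φ a.2 a.1)} := by
      rw [hpre, image_preimage_eq_iff]
      intro a ha
      exact (mem_range_chart (ι := id) hφ _).2 ⟨_, hK ha, rfl⟩
    rw [himg]
    refine (isCompact_univ.prod hf.isCompact).of_isClosed_subset
      ⟨isOpen_of_slices fun g => (hc g).compl.isOpen⟩ fun a ha => ⟨mem_univ _, a.1, ha⟩
  · rw [hpre]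
    exact (isOpen_of_slices fun g => (hc g).isOpen).preimage hi.continuous

/-! ### Null sets of invariant measures -/

section Measure

open MeasureTheory

/-- Invariance applied to the bisection over `O × {g}` gives the equality for open `O ⊆ D`. Open
sets form a π-system, so it extends to Borel sets inside `D`. -/
theorem measure_image_eq (hφ : IsFreeAction φ) {R : Setoid X} (hR : R ≤ orbitRel φ)
    {T : TopologicalSpace (RelGraph R)}
    (hT : T = TopologicalSpace.induced (chart (ι := id) fun _ _ h => hR h) inferInstance)
    [MeasurableSpace X] [BorelSpace X] {μ : Measure X} [IsFiniteMeasure μ]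
    (hμ : ∀ U : Set (RelGraph R), IsOpen U → InjOn RelGraph.fst U → InjOn RelGraph.snd U →
      μ (RelGraph.fst '' U) = μ (RelGraph.snd '' U)) {g : G} (ho : IsOpen {x | R x (φ g x)})
    {A : Set X} (hA : MeasurableSet A) (hAg : ∀ x ∈ A, R x (φ g x)) : μ (φ g '' A) = μ A := by
  set D := {x | R x (φ g x)}
  have hi : IsInducing (chart (S := R) (ι := id) fun _ _ h => hR h) := ⟨hT⟩
  have hopen : ∀ O, IsOpen O → O ⊆ D → μ (φ g '' O) = μ O := by
    intro O hO hOD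
    let U : Set (RelGraph R) := chart (ι := id) (fun _ _ h => hR h) ⁻¹' (O ×ˢ {g})
    have hU : ∀ q ∈ U, q.fst ∈ O ∧ φ g q.fst = q.snd := by
      rintro q ⟨h1, h2⟩
      refine ⟨h1, ?_⟩
      have := cocycle_spec (S := R) (ι := id) (fun _ _ h => hR h) q
      rwa [show cocycle (ι := id) (fun _ _ h => hR h) q = g from h2] at this
    have hU' : ∀ x (hx : x ∈ O), (⟨x, φ g x, hOD hx⟩ : RelGraph R) ∈ U := fun x hx =>
      ⟨hx, cocycle_eq (ι := id) hφ (fun _ _ h => hR h) rfl⟩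
    have h1 : RelGraph.fst '' U = O := by
      ext x
      exact ⟨by rintro ⟨q, hq, rfl⟩; exact (hU q hq).1, fun hx => ⟨_, hU' x hx, rfl⟩⟩
    have h2 : RelGraph.snd '' U = φ g '' O := by
      ext x
      constructor
      · rintro ⟨q, hq, rfl⟩; exact ⟨q.fst, hU q hq⟩
      · rintro ⟨y, hy, rfl⟩; exact ⟨_, hU' y hy, rfl⟩
    conv_rhs => rw [← h1]
    rw [← h2]
    refine (hμ U ((hO.prod (isOpen_discrete _)).preimage hi.continuous) ?_ ?_).symm
    · intro q hq r hr hqr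
      exact RelGraph.ext hqr (by rw [← (hU q hq).2, ← (hU r hr).2, hqr])
    · intro q hq r hr hqr
      refine RelGraph.ext ((φ g).injective ?_) hqr
      rw [(hU q hq).2, (hU r hr).2, hqr]
  have hmeas : Measurable (φ g).symm := (Homeomorph.continuous _).measurable
  have key : (μ.map (φ g).symm).restrict D = μ.restrict D := by
    have : ∀ O, IsOpen O → (μ.map (φ g).symm).restrict D O = μ.restrict D O := by
      intro O hO
      rw [Measure.restrict_apply hO.measurableSet, Measure.restrict_apply hO.measurableSet,
        Measure.map_apply hmeas (hO.inter ho).measurableSet, ← Homeomorph.image_eq_preimage_symm,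
        hopen _ (hO.inter ho) inter_subset_right]
    exact ext_of_generate_finite _ BorelSpace.measurable_eq
      isPiSystem_isOpen this (this _ isOpen_univ)
  have := congrArg (fun ν => ν A) key
  simp only [Measure.restrict_apply hA, inter_eq_self_of_subset_left (show A ⊆ D from hAg)] at this
  rwa [Measure.map_apply hmeas hA, ← Homeomorph.image_eq_preimage_symm] at this

/-- All points of a class have the same mass, and the class is infinite. -/
theorem measure_singleton_eq_zero [T1Space X] (hφ : IsFreeAction φ) {R : Setoid X}
    (hR : R ≤ orbitRel φ) {T : TopologicalSpace (RelGraph R)}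
    (hT : T = TopologicalSpace.induced (chart (ι := id) fun _ _ h => hR h) inferInstance)
    [MeasurableSpace X] [BorelSpace X] {μ : Measure X} [IsFiniteMeasure μ]
    (hμ : ∀ U : Set (RelGraph R), IsOpen U → InjOn RelGraph.fst U → InjOn RelGraph.snd U →
      μ (RelGraph.fst '' U) = μ (RelGraph.snd '' U)) (ho : ∀ g, IsOpen {x | R x (φ g x)})
    {x : X} (hx : {y | R x y}.Infinite) : μ {x} = 0 := by
  by_contra hne
  refine measure_ne_top μ {y | R x y} (hx.meas_eq_top ⟨μ {x}, hne, fun y hy => ?_⟩)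
  obtain ⟨g, rfl⟩ := hR hy
  have := measure_image_eq hφ hR hT hμ (ho g) (measurableSet_singleton x)
    fun z hz => by rw [mem_singleton_iff.1 hz]; exact hy
  rw [← this, image_singleton]

/-- Off the null set `C`, the powers of `g` produce infinitely many disjoint copies of `A` of equal
measure in a finite measure space. -/
theorem measure_eq_zero_of_translates [T1Space X] (hφ : IsFreeAction φ) {R : Setoid X}
    (hR : R ≤ orbitRel φ) {T : TopologicalSpace (RelGraph R)}
    (hT : T = TopologicalSpace.induced (chart (ι := id) fun _ _ h => hR h) inferInstance)
    [MeasurableSpace X] [BorelSpace X] {μ : Measure X} [IsFiniteMeasure μ]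
    (hμ : ∀ U : Set (RelGraph R), IsOpen U → InjOn RelGraph.fst U → InjOn RelGraph.snd U →
      μ (RelGraph.fst '' U) = μ (RelGraph.snd '' U)) (ho : ∀ g, IsOpen {x | R x (φ g x)})
    (hinf : ∀ x, {y | R x y}.Infinite) {A C : Set X} (hA : MeasurableSet A) (hC : C.Countable)
    (g : G) (hg : ∀ k : ℕ, ∀ x ∈ A, x ∉ C → R x (φ (g ^ k) x))
    (hdisj : ∀ k l : ℕ, ∀ x ∈ A, ∀ y ∈ A, φ (g ^ k) x = φ (g ^ l) y → k = l) : μ A = 0 := by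
  have hC0 : μ C = 0 := by
    rw [← biUnion_of_singleton C, measure_biUnion_null_iff hC]
    exact fun x _ => measure_singleton_eq_zero hφ hR hT hμ ho (hinf x)
  have hm := hA.diff hC.measurableSet
  rw [← measure_sdiff_null hC0]
  by_contra hne
  have hd : Pairwise (Function.onFun Disjoint fun k : ℕ => φ (g ^ k) '' (A \ C)) := by
    intro k l hkl
    rw [Function.onFun, disjoint_left]
    rintro _ ⟨x, hx, rfl⟩ ⟨y, hy, hxy⟩
    exact hkl (hdisj k l x hx.1 y hy.1 hxy.symm)
  have := measure_iUnion (μ := μ) hd fun k => by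
    rw [Homeomorph.image_eq_preimage_symm]
    exact (Homeomorph.continuous _).measurable hm
  simp_rw [fun k => measure_image_eq hφ hR hT hμ (ho (g ^ k)) hm fun x hx => hg k x hx.1 hx.2] at this
  rw [ENNReal.tsum_const_eq_top_of_ne_zero hne] at this
  exact measure_ne_top μ _ this

end Measure

end Chart

/-! ### Tiles, their pieces and the limit relation -/

section Tiles

variable {X₁ X₂ : Type*} [TopologicalSpace X₁] [TopologicalSpace X₂]
  {f₁ : X₁ ≃ₜ X₁} {f₂ : X₂ ≃ₜ X₂} {p₁ : X₁} {p₂ : X₂} (A : Towers f₁ p₁) (C : Towers f₂ p₂)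

/-- The position of the tile of level `n` at `x` in the tile of level `n + 1`. -/
def tileType (n : ℕ) (x : X₁ × X₂) : Option Bool × Option Bool := (A.side n x.1, C.side n x.2)

/-- The type of a tile that lies at a corner of the next larger tile. -/
def IsCorner (t : Option Bool × Option Bool) : Prop := ∃ s : Bool × Bool, t = (some s.1, some s.2)

/-- A tile at a corner of the next larger one is divided into two pieces, one along each of the two
sides that meet at that corner; `true` stands for the side where the second coordinate is
extremal. -/
def piece : ℕ → X₁ × X₂ → Bool
  -- This initial choice decides where the four corner points go: to vertical pieces (`false`) if
  -- the two sides agree, to horizontal ones (`true`) otherwise.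
  | 0, x => decide (A.side 0 x.1 ≠ C.side 0 x.2)
  | n + 1, x =>
    -- Only the subtile at the same corner keeps its division. Any other subtile goes entirely to
    -- the horizontal piece if it lies in the extremal row, and to the vertical piece if not.
    if tileType A C n x = tileType A C (n + 1) x then piece n x
    else decide (C.side n x.2 = C.side (n + 1) x.2)

variable {A C}

theorem tileType_eq {n : ℕ} {x y : X₁ × X₂} (h₁ : A.rel n x.1 y.1) (h₂ : C.rel n x.2 y.2) :
    tileType A C n x = tileType A C n y :=
  Prod.ext (A.side_eq h₁) (C.side_eq h₂)

theorem isLocallyConstant_tileType (n : ℕ) : IsLocallyConstant (tileType A C n) :=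
  ((A.isLocallyConstant_side n).comp_continuous continuous_fst).prodMk
    ((C.isLocallyConstant_side n).comp_continuous continuous_snd)

theorem isLocallyConstant_piece (n : ℕ) : IsLocallyConstant (piece A C n) := by
  induction n with
  | zero =>
    exact (isLocallyConstant_tileType (A := A) (C := C) 0).comp fun t => decide (t.1 ≠ t.2)
  | succ n ih =>
    rw [IsLocallyConstant.iff_eventually_eq] at ih ⊢
    intro x
    filter_upwards [ih x,
      (IsLocallyConstant.iff_eventually_eq _).1 (isLocallyConstant_tileType (A := A) (C := C) n) x,
      (IsLocallyConstant.iff_eventually_eq _).1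
        (isLocallyConstant_tileType (A := A) (C := C) (n + 1)) x] with y h0 h1 h2
    have h3 : C.side n y.2 = C.side n x.2 := congrArg Prod.snd h1
    have h4 : C.side (n + 1) y.2 = C.side (n + 1) x.2 := congrArg Prod.snd h2
    simp only [piece, h0, h1, h2, h3, h4]

theorem piece_succ_of_eq {n : ℕ} {x : X₁ × X₂} (h : tileType A C n x = tileType A C (n + 1) x) :
    piece A C (n + 1) x = piece A C n x := by
  rw [piece, if_pos h]

theorem piece_succ_of_ne {n : ℕ} {x : X₁ × X₂} (h : tileType A C n x ≠ tileType A C (n + 1) x) :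
    piece A C (n + 1) x = decide (C.side n x.2 = C.side (n + 1) x.2) := by
  rw [piece, if_neg h]

variable (A C)

/-- The partition of the orbits into the pieces of the tiles of level `n`. -/
def tileRel (n : ℕ) : Setoid (X₁ × X₂) where
  r x y := A.rel n x.1 y.1 ∧ C.rel n x.2 y.2 ∧
    (IsCorner (tileType A C n x) → piece A C n x = piece A C n y)
  iseqv :=
    { refl := fun x => ⟨(A.rel n).refl _, (C.rel n).refl _, fun _ => rfl⟩
      symm := fun {x y} h => ⟨(A.rel n).symm h.1, (C.rel n).symm h.2.1, fun hc =>
        (h.2.2 (by rwa [tileType_eq h.1 h.2.1])).symm⟩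
      trans := fun {x y z} h h' => ⟨(A.rel n).trans h.1 h'.1, (C.rel n).trans h.2.1 h'.2.1,
        fun hc => (h.2.2 hc).trans (h'.2.2 (by rwa [← tileType_eq h.1 h.2.1]))⟩ }

variable {A C}

/-- When the corner changes, the new piece is computed from sides alone, so it is constant on the
whole smaller tile: the old division is forgotten. -/
theorem tileRel_succ_of_ne {n : ℕ} {x y : X₁ × X₂} (h₁ : A.rel n x.1 y.1) (h₂ : C.rel n x.2 y.2)
    (hne : tileType A C n x ≠ tileType A C (n + 1) x) : tileRel A C (n + 1) x y := by
  have h₁' := A.rel_mono n.le_succ h₁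
  have h₂' := C.rel_mono n.le_succ h₂
  refine ⟨h₁', h₂', fun _ => ?_⟩
  rw [piece_succ_of_ne hne, piece_succ_of_ne, C.side_eq h₂, C.side_eq h₂']
  rwa [← tileType_eq h₁ h₂, ← tileType_eq h₁' h₂']

theorem monotone_tileRel : Monotone (tileRel A C) := by
  refine monotone_nat_of_le_succ fun n x y ⟨h₁, h₂, h⟩ => ?_
  by_cases hne : tileType A C n x = tileType A C (n + 1) x
  · have h₁' := A.rel_mono n.le_succ h₁
    have h₂' := C.rel_mono n.le_succ h₂
    refine ⟨h₁', h₂', fun hc => ?_⟩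
    rw [piece_succ_of_eq hne, piece_succ_of_eq, h (hne ▸ hc)]
    rwa [← tileType_eq h₁ h₂, ← tileType_eq h₁' h₂']
  · exact tileRel_succ_of_ne h₁ h₂ hne

variable (A C)

/-- The union of the increasing sequence of the relations `tileRel A C n`. -/
def limitRel : Setoid (X₁ × X₂) where
  r x y := ∃ n, tileRel A C n x y
  iseqv :=
    { refl := fun x => ⟨0, (tileRel A C 0).refl x⟩
      symm := fun ⟨n, h⟩ => ⟨n, (tileRel A C n).symm h⟩
      trans := fun ⟨m, h⟩ ⟨n, h'⟩ => ⟨max m n, (tileRel A C _).trans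
        (monotone_tileRel (le_max_left m n) h) (monotone_tileRel (le_max_right m n) h')⟩ }

variable {A C}

theorem tileRel_le (n : ℕ) : tileRel A C n ≤ limitRel A C := fun _ _ h => ⟨n, h⟩

/-- A division can separate two points of a tile forever only if the tile type is one fixed corner
from level `N` on: a tile off the corners is undivided, and a change of type erases the division. -/
theorem limitRel_or_corner {N : ℕ} {x y : X₁ × X₂} (h₁ : A.rel N x.1 y.1) (h₂ : C.rel N x.2 y.2) :
    limitRel A C x y ∨ ∃ s₁ s₂, ∀ n ≥ N, tileType A C n x = (some s₁, some s₂) := by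
  by_cases hc : IsCorner (tileType A C N x)
  · obtain ⟨⟨s₁, s₂⟩, hs⟩ := hc
    by_cases h : ∃ n ≥ N, tileType A C n x ≠ tileType A C (n + 1) x
    · obtain ⟨n, hn, hne⟩ := h
      exact Or.inl ⟨n + 1, tileRel_succ_of_ne (A.rel_mono hn h₁) (C.rel_mono hn h₂) hne⟩
    · push Not at h
      refine Or.inr ⟨s₁, s₂, fun n hn => ?_⟩
      induction n, hn using Nat.le_induction with
      | base => exact hs
      | succ n hn ih => rw [← h n hn, ih]
  · exact Or.inl ⟨N, h₁, h₂, fun h => absurd h hc⟩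

theorem piece_eq_of_le {N : ℕ} {x : X₁ × X₂} {t : Option Bool × Option Bool}
    (h : ∀ n ≥ N, tileType A C n x = t) {n : ℕ} (hn : N ≤ n) :
    piece A C n x = piece A C N x := by
  induction n, hn using Nat.le_induction with
  | base => rfl
  | succ n hn ih => rw [piece_succ_of_eq (by rw [h n hn, h _ (by omega)]), ih]

/-- A point of a vertical side other than the corner is at some level outside the extremal row. When
its tile next reaches the corner type it is put in the vertical piece, and this is inherited. -/
theorem piece_eq_false {x : X₁ × X₂} {s₁ s₂ : Bool} (h₁ : ∀ n, A.side n x.1 = some s₁) {i j : ℕ}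
    (hij : i < j) (hi : C.side i x.2 ≠ some s₂) (hj : C.side j x.2 = some s₂) :
    piece A C j x = false := by
  induction j with
  | zero => omega
  | succ j ih =>
    by_cases h : C.side j x.2 = some s₂
    · have hij' : i < j := lt_of_le_of_ne (Nat.lt_succ_iff.1 hij) fun h' => hi (h' ▸ h)
      rw [piece_succ_of_eq, ih hij' h]
      exact Prod.ext ((h₁ _).trans (h₁ _).symm) (h.trans hj.symm)
    · have hne : C.side j x.2 ≠ C.side (j + 1) x.2 := by rwa [hj]
      rw [piece_succ_of_ne fun h' => hne (congrArg Prod.snd h')]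
      exact decide_eq_false hne

theorem piece_eq_true {x : X₁ × X₂} {s₁ s₂ : Bool} (h₂ : ∀ n, C.side n x.2 = some s₂) {i j : ℕ}
    (hij : i < j) (hi : A.side i x.1 ≠ some s₁) (hj : A.side j x.1 = some s₁) :
    piece A C j x = true := by
  induction j with
  | zero => omega
  | succ j ih =>
    by_cases h : A.side j x.1 = some s₁
    · have hij' : i < j := lt_of_le_of_ne (Nat.lt_succ_iff.1 hij) fun h' => hi (h' ▸ h)
      rw [piece_succ_of_eq, ih hij' h]
      exact Prod.ext (h.trans hj.symm) ((h₂ _).trans (h₂ _).symm)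
    · rw [piece_succ_of_ne fun h' => h ((congrArg Prod.fst h').trans hj)]
      exact decide_eq_true ((h₂ _).trans (h₂ _).symm)

theorem exists_piece_eq_false {s₁ s₂ : Bool} {x₂ : X₂} (hx : x₂ ≠ C.endpt s₂) :
    ∃ M, ∀ n ≥ M, C.side n x₂ = some s₂ → piece A C n (A.endpt s₁, x₂) = false := by
  obtain ⟨i, hi⟩ := C.exists_side_ne_of_ne hx
  exact ⟨i + 1, fun n hn h => piece_eq_false (A.side_endpt s₁) hn hi h⟩

theorem exists_piece_eq_true {s₁ s₂ : Bool} {x₁ : X₁} (hx : x₁ ≠ A.endpt s₁) :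
    ∃ M, ∀ n ≥ M, A.side n x₁ = some s₁ → piece A C n (x₁, C.endpt s₂) = true := by
  obtain ⟨i, hi⟩ := A.exists_side_ne_of_ne hx
  exact ⟨i + 1, fun n hn h => piece_eq_true (C.side_endpt s₂) hn hi h⟩

theorem limitRel_of_piece_eq {N : ℕ} {x y : X₁ × X₂} (h₁ : A.rel N x.1 y.1) (h₂ : C.rel N x.2 y.2)
    (h : ∀ s₁ s₂, (∀ n ≥ N, tileType A C n x = (some s₁, some s₂)) →
      (∀ n ≥ N, tileType A C n y = (some s₁, some s₂)) →
      ∃ n ≥ N, piece A C n x = piece A C n y) : limitRel A C x y := by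
  obtain hl | ⟨s₁, s₂, hs⟩ := limitRel_or_corner h₁ h₂
  · exact hl
  · obtain ⟨n, hn, hp⟩ := h s₁ s₂ hs fun n hn => by
      rw [← hs n hn, tileType_eq (A.rel_mono hn h₁) (C.rel_mono hn h₂)]
    exact ⟨n, A.rel_mono hn h₁, C.rel_mono hn h₂, fun _ => hp⟩

/-- Both points eventually lie in the vertical piece whenever their tile is divided, so the division
never separates them. -/
theorem limitRel_vertical_iff {s : Bool} {x₂ y₂ : X₂} (hx : ∀ s, x₂ ≠ C.endpt s)
    (hy : ∀ s, y₂ ≠ C.endpt s) :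
    limitRel A C (A.endpt s, x₂) (A.endpt s, y₂) ↔ ∃ n, C.rel n x₂ y₂ := by
  refine ⟨fun ⟨n, h⟩ => ⟨n, h.2.1⟩, fun ⟨N, h⟩ => ?_⟩
  refine limitRel_of_piece_eq (N := N) ((A.rel N).refl _) h fun s₁ s₂ h₁ h₂ => ?_
  obtain ⟨M, hM⟩ := exists_piece_eq_false (A := A) (s₁ := s) (hx s₂)
  obtain ⟨M', hM'⟩ := exists_piece_eq_false (A := A) (s₁ := s) (hy s₂)
  refine ⟨max N (max M M'), by omega, ?_⟩
  rw [hM _ (by omega) (congrArg Prod.snd (h₁ _ (by omega))),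
    hM' _ (by omega) (congrArg Prod.snd (h₂ _ (by omega)))]

theorem limitRel_horizontal_iff {s : Bool} {x₁ y₁ : X₁} (hx : ∀ s, x₁ ≠ A.endpt s)
    (hy : ∀ s, y₁ ≠ A.endpt s) :
    limitRel A C (x₁, C.endpt s) (y₁, C.endpt s) ↔ ∃ n, A.rel n x₁ y₁ := by
  refine ⟨fun ⟨n, h⟩ => ⟨n, h.1⟩, fun ⟨N, h⟩ => ?_⟩
  refine limitRel_of_piece_eq (N := N) h ((C.rel N).refl _) fun s₁ s₂ h₁ h₂ => ?_
  obtain ⟨M, hM⟩ := exists_piece_eq_true (C := C) (s₂ := s) (hx s₁)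
  obtain ⟨M', hM'⟩ := exists_piece_eq_true (C := C) (s₂ := s) (hy s₁)
  refine ⟨max N (max M M'), by omega, ?_⟩
  rw [hM _ (by omega) (congrArg Prod.fst (h₁ _ (by omega))),
    hM' _ (by omega) (congrArg Prod.fst (h₂ _ (by omega)))]

theorem not_limitRel_vertical_horizontal {s₁ s₂ : Bool} {x₂ : X₂} {y₁ : X₁}
    (hx : x₂ ≠ C.endpt s₂) (hy : y₁ ≠ A.endpt s₁) :
    ¬ limitRel A C (A.endpt s₁, x₂) (y₁, C.endpt s₂) := by
  rintro ⟨N, h⟩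
  obtain ⟨M, hM⟩ := exists_piece_eq_false (A := A) (s₁ := s₁) hx
  obtain ⟨M', hM'⟩ := exists_piece_eq_true (C := C) (s₂ := s₂) hy
  obtain ⟨h₁, h₂, h₃⟩ := monotone_tileRel (le_max_left N (max M M')) h
  set n := max N (max M M')
  have e₁ : A.side n y₁ = some s₁ := by rw [← A.side_eq h₁, A.side_endpt]
  have e₂ : C.side n x₂ = some s₂ := by rw [C.side_eq h₂, C.side_endpt]
  have := h₃ ⟨(s₁, s₂), Prod.ext (A.side_endpt s₁ n) e₂⟩
  rw [hM n (by omega) e₂, hM' n (by omega) e₁] at this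
  exact Bool.false_ne_true this

/-- Each quadrant has exactly two pieces to choose from, represented by a point of its vertical side
and a point of its horizontal side. In a quadrant the type is constant from level `N` on, so the
piece of `x` is too. -/
theorem limitRel_quadrant {N : ℕ} {s₁ s₂ : Bool} {x : X₁ × X₂} (h₁ : A.rel N x.1 (A.endpt s₁))
    (h₂ : C.rel N x.2 (C.endpt s₂)) {w : X₁} {u : X₂} (hw : A.rel N w (A.endpt s₁))
    (hu : C.rel N u (C.endpt s₂)) (hw' : w ≠ A.endpt s₁) (hu' : u ≠ C.endpt s₂) :
    (limitRel A C x (A.endpt s₁, u) ∧ ∀ n ≥ N, piece A C n x = false) ∨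
      (limitRel A C x (w, C.endpt s₂) ∧ ∀ n ≥ N, piece A C n x = true) := by
  have hx : ∀ n ≥ N, tileType A C n x = (some s₁, some s₂) := fun n hn =>
    Prod.ext ((A.side_eq (A.rel_mono hn h₁)).trans (A.side_endpt s₁ n))
      ((C.side_eq (C.rel_mono hn h₂)).trans (C.side_endpt s₂ n))
  obtain ⟨M, hM⟩ := exists_piece_eq_false (A := A) (s₁ := s₁) hu'
  obtain ⟨M', hM'⟩ := exists_piece_eq_true (C := C) (s₂ := s₂) hw'
  have hle := le_max_left N (max M M')
  have hn := piece_eq_of_le hx hle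
  cases hp : piece A C N x with
  | false =>
    refine Or.inl ⟨⟨max N (max M M'), A.rel_mono hle h₁,
      C.rel_mono hle ((C.rel N).trans h₂ ((C.rel N).symm hu)), fun _ => ?_⟩,
      fun n hn => (piece_eq_of_le hx hn).trans hp⟩
    rw [hn, hp, hM _ (by omega)]
    rw [C.side_eq (C.rel_mono hle hu), C.side_endpt]
  | true =>
    refine Or.inr ⟨⟨max N (max M M'), A.rel_mono hle ((A.rel N).trans h₁ ((A.rel N).symm hw)),
      C.rel_mono hle h₂, fun _ => ?_⟩,
      fun n hn => (piece_eq_of_le hx hn).trans hp⟩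
    rw [hn, hp, hM' _ (by omega)]
    rw [A.side_eq (A.rel_mono hle hw), A.side_endpt]

theorem piece_corner (s₁ s₂ : Bool) (n : ℕ) :
    piece A C n (A.endpt s₁, C.endpt s₂) = decide (s₁ ≠ s₂) := by
  have h : ∀ n, tileType A C n (A.endpt s₁, C.endpt s₂) = (some s₁, some s₂) := fun n =>
    Prod.ext (A.side_endpt s₁ n) (C.side_endpt s₂ n)
  rw [piece_eq_of_le (N := 0) (fun n _ => h n) n.zero_le, piece, A.side_endpt, C.side_endpt]
  simp

/-- From some level on every tile meets a given box, so it suffices that the class of `x` contains a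
whole tile of such a level, or meets the box already. -/
theorem isMinimalRel_limitRel : IsMinimalRel (limitRel A C) := by
  intro x
  refine dense_iff_inter_open.2 fun W hW ⟨⟨a, c⟩, hac⟩ => ?_
  obtain ⟨W₁, W₂, hW₁, hW₂, ha, hc, hsub⟩ := isOpen_prod_iff.1 hW a c hac
  obtain ⟨N₁, hN₁⟩ := A.exists_mem hW₁ ⟨a, ha⟩
  obtain ⟨N₂, hN₂⟩ := C.exists_mem hW₂ ⟨c, hc⟩
  set N := max N₁ N₂
  have hit : ∀ n ≥ N, ∀ z : X₁ × X₂, ∃ y ∈ W, A.rel n z.1 y.1 ∧ C.rel n z.2 y.2 := by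
    intro n hn z
    obtain ⟨y₁, hy₁, h₁⟩ := hN₁ n (by omega) z.1
    obtain ⟨y₂, hy₂, h₂⟩ := hN₂ n (by omega) z.2
    exact ⟨(y₁, y₂), hsub ⟨hy₁, hy₂⟩, h₁, h₂⟩
  obtain ⟨y, hy, h₁, h₂⟩ := hit N le_rfl x
  obtain h | ⟨s₁, s₂, hs⟩ := limitRel_or_corner h₁ h₂
  · exact ⟨y, hy, h⟩
  -- Each piece of a divided tile contains an undivided subtile away from the corner: one outside
  -- the extremal row for `false`, a noncorner one inside it for `true`.
  have key : ∃ z, A.rel (N + 1) x.1 z.1 ∧ C.rel (N + 1) x.2 z.2 ∧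
      tileType A C N z ≠ (some s₁, some s₂) ∧
      decide (C.side N z.2 = some s₂) = piece A C (N + 1) x := by
    cases piece A C (N + 1) x with
    | false =>
      obtain ⟨z₂, hz, hne⟩ := C.exists_side_ne N x.2 s₂
      exact ⟨(x.1, z₂), (A.rel _).refl _, hz, fun h => hne (congrArg Prod.snd h),
        decide_eq_false hne⟩
    | true =>
      obtain ⟨z₁, hz, hne⟩ := A.exists_side_ne N x.1 s₁
      exact ⟨(z₁, x.2), hz, (C.rel _).refl _, fun h => hne (congrArg Prod.fst h),
        decide_eq_true (congrArg Prod.snd (hs N le_rfl))⟩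
  obtain ⟨z, hz₁, hz₂, hne, hp⟩ := key
  have hz : tileType A C (N + 1) z = (some s₁, some s₂) := by
    rw [← tileType_eq hz₁ hz₂, hs _ (by omega)]
  obtain ⟨y, hy, h₁, h₂⟩ := hit N le_rfl z
  refine ⟨y, hy, (limitRel A C).trans (b := z) ⟨N + 1, hz₁, hz₂, fun _ => ?_⟩
    ⟨N + 1, tileRel_succ_of_ne h₁ h₂ (by rwa [hz])⟩⟩
  rw [piece_succ_of_ne (x := z) (by rwa [hz]), ← hp,
    show C.side (N + 1) z.2 = some s₂ from congrArg Prod.snd hz]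

end Tiles

/-! ### Consequences of the Cantor minimal hypotheses -/

section System

variable {X : Type*} [TopologicalSpace X] {f : X ≃ₜ X}

theorem IsCantorMinimalSystem.zpow_apply_ne (h : IsCantorMinimalSystem (intAction f)) (k : ℤ)
    (hk : k ≠ 0) (x : X) : (f ^ k) x ≠ x :=
  h.free (Multiplicative.ofAdd k) hk x

theorem IsCantorMinimalSystem.dense_zpow (h : IsCantorMinimalSystem (intAction f)) (x : X) :
    Dense {y | ∃ k : ℤ, (f ^ k) x = y} :=
  h.isMinimalRel x

theorem IsCantorSet.compactSpace (h : IsCantorSet X) : CompactSpace X :=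
  h.some.symm.compactSpace

theorem IsCantorSet.t2Space (h : IsCantorSet X) : T2Space X :=
  h.some.isEmbedding.t2Space

theorem IsCantorSet.secondCountableTopology (h : IsCantorSet X) : SecondCountableTopology X :=
  h.some.secondCountableTopology

theorem IsCantorSet.totallyDisconnectedSpace (h : IsCantorSet X) : TotallyDisconnectedSpace X :=
  ⟨h.some.isEmbedding.isTotallyDisconnected (isTotallyDisconnected_of_totallyDisconnectedSpace _)⟩

end System

/-! ### The product action, the cross and `β` -/

section Product

variable {X₁ X₂ : Type*} [TopologicalSpace X₁] [TopologicalSpace X₂]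
  {f₁ : X₁ ≃ₜ X₁} {f₂ : X₂ ≃ₜ X₂}

theorem prodAction_apply (g : Multiplicative (ℤ × ℤ)) (x : X₁ × X₂) :
    prodAction f₁ f₂ g x = ((f₁ ^ g.toAdd.1) x.1, (f₂ ^ g.toAdd.2) x.2) := rfl

theorem isFreeAction_prodAction (h₁ : ∀ k : ℤ, k ≠ 0 → ∀ x, (f₁ ^ k) x ≠ x)
    (h₂ : ∀ k : ℤ, k ≠ 0 → ∀ x, (f₂ ^ k) x ≠ x) : IsFreeAction (prodAction f₁ f₂) := by
  intro g hg x hx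
  rw [prodAction_apply] at hx
  apply hg
  have e₁ : g.toAdd.1 = 0 := by_contra fun h => h₁ _ h x.1 (congrArg Prod.fst hx)
  have e₂ : g.toAdd.2 = 0 := by_contra fun h => h₂ _ h x.2 (congrArg Prod.snd hx)
  exact Multiplicative.toAdd.injective (Prod.ext e₁ e₂)

theorem setoid_zpow {X : Type*} [TopologicalSpace X] {S : Setoid X} {f : X ≃ₜ X}
    (h : ∀ x, S x (f x)) (k : ℤ) (x : X) : S x ((f ^ k) x) := by
  induction k with
  | zero => rw [zpow_zero, Homeomorph.one_apply]
  | succ k ih =>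
    rw [zpow_succ_apply, zpow_apply_comm]
    exact S.trans ih (h _)
  | pred k ih =>
    refine S.trans ih (S.symm ?_)
    have := h ((f ^ (-(k : ℤ) - 1)) x)
    rwa [← zpow_apply_comm, ← zpow_succ_apply, sub_add_cancel] at this

theorem orbitRel_le_of_generators {S : Setoid (X₁ × X₂)} (h₁ : ∀ x, S x (f₁ x.1, x.2))
    (h₂ : ∀ x, S x (x.1, f₂ x.2)) : orbitRel (prodAction f₁ f₂) ≤ S := by
  rintro x _ ⟨g, rfl⟩
  have e₁ := setoid_zpow (S := S.comap fun z => (z, x.2)) (f := f₁) (fun z => h₁ (z, x.2))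
    g.toAdd.1 x.1
  have e₂ := setoid_zpow (S := S.comap fun z => ((f₁ ^ g.toAdd.1) x.1, z)) (f := f₂)
    (fun z => h₂ (_, z)) g.toAdd.2 x.2
  exact S.trans e₁ e₂

variable {p₁ : X₁} {p₂ : X₂} {A : Towers f₁ p₁} {C : Towers f₂ p₂}

theorem limitRel_le_orbitRel : limitRel A C ≤ orbitRel (prodAction f₁ f₂) := by
  rintro x y ⟨n, h₁, h₂, -⟩
  obtain ⟨k, hk⟩ := A.exists_zpow h₁
  obtain ⟨l, hl⟩ := C.exists_zpow h₂
  exact ⟨Multiplicative.ofAdd (k, l), Prod.ext hk hl⟩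

theorem isClopen_tileRel (n : ℕ) (g : Multiplicative (ℤ × ℤ)) :
    IsClopen {x | tileRel A C n x (prodAction f₁ f₂ g x)} := by
  have h₁ := (A.isClopen_rel n g.toAdd.1).preimage (continuous_fst (Y := X₂))
  have h₂ := (C.isClopen_rel n g.toAdd.2).preimage (continuous_snd (X := X₁))
  have hp := isLocallyConstant_piece (A := A) (C := C) n
  have h₃ : IsLocallyConstant fun x => (tileType A C n x, piece A C n x,
      piece A C n (prodAction f₁ f₂ g x)) :=
    (isLocallyConstant_tileType n).prodMk (hp.prodMk (hp.comp_continuous (Homeomorph.continuous _)))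
  exact h₁.inter (h₂.inter ⟨⟨h₃ {t | IsCorner t.1 → t.2.1 = t.2.2}ᶜ⟩,
    h₃ {t | IsCorner t.1 → t.2.1 = t.2.2}⟩)

theorem finite_tileRel (n : ℕ) :
    {g | ∃ x, tileRel A C n x (prodAction f₁ f₂ g x)}.Finite := by
  refine (((A.finite_rel n).prod (C.finite_rel n)).preimage
    Multiplicative.toAdd.injective.injOn).subset ?_
  rintro g ⟨x, h₁, h₂, -⟩
  exact ⟨⟨_, h₁⟩, ⟨_, h₂⟩⟩

theorem isOpen_limitRel (g : Multiplicative (ℤ × ℤ)) :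
    IsOpen {x | limitRel A C x (prodAction f₁ f₂ g x)} := by
  have : {x | limitRel A C x (prodAction f₁ f₂ g x)} =
      ⋃ n, {x | tileRel A C n x (prodAction f₁ f₂ g x)} := by
    ext x; simp only [mem_iUnion]; rfl
  rw [this]
  exact isOpen_iUnion fun n => (isClopen_tileRel n g).isOpen

variable {U₁ : Set X₁} {U₂ : Set X₂}

theorem not_limitRel_of_mem_cross (hA : ∀ s, A.endpt s ∉ U₁) (hC : ∀ s, C.endpt s ∉ U₂) {s t : Bool}
    {x₂ : X₂} {y₁ : X₁} (hx : x₂ ∈ U₂) (hy : y₁ ∈ U₁) :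
    ¬ limitRel A C (A.endpt s, x₂) (y₁, C.endpt t) :=
  not_limitRel_vertical_horizontal (fun h => hC t (h ▸ hx)) fun h => hA s (h ▸ hy)

theorem limitRel_left_iff (hC : ∀ s, C.endpt s ∉ U₂) {s : Bool} {x₂ y₂ : X₂} (hx : x₂ ∈ U₂)
    (hy : y₂ ∈ U₂) : limitRel A C (A.endpt s, x₂) (A.endpt s, y₂) ↔ ∃ n, C.rel n x₂ y₂ :=
  limitRel_vertical_iff (fun t h => hC t (h ▸ hx)) fun t h => hC t (h ▸ hy)

theorem limitRel_right_iff (hA : ∀ s, A.endpt s ∉ U₁) {s : Bool} {x₁ y₁ : X₁} (hx : x₁ ∈ U₁)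
    (hy : y₁ ∈ U₁) : limitRel A C (x₁, C.endpt s) (y₁, C.endpt s) ↔ ∃ n, A.rel n x₁ y₁ :=
  limitRel_horizontal_iff (fun t h => hA t (h ▸ hx)) fun t h => hA t (h ▸ hy)

/-- The two arms of the cross are relatively open and unrelated. A related pair in one arm differs
by a power of one factor, which keeps nearby points of that arm in it. -/
theorem isOpen_limitRel_cross (hU₁ : IsClopen U₁) (hU₂ : IsClopen U₂) (hA : ∀ s, A.endpt s ∉ U₁)
    (hC : ∀ s, C.endpt s ∉ U₂) (s : Bool) (g : Multiplicative (ℤ × ℤ)) :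
    IsOpen {x : cross U₁ U₂ (A.endpt s) (C.endpt s) | ∃ y : cross U₁ U₂ (A.endpt s) (C.endpt s),
      restrictRel (limitRel A C) _ x y ∧ prodAction f₁ f₂ g x = y} := by
  have hc : Continuous (Subtype.val : cross U₁ U₂ (A.endpt s) (C.endpt s) → X₁ × X₂) :=
    continuous_subtype_val
  have ho := (isOpen_limitRel (A := A) (C := C) g).preimage hc
  rw [isOpen_iff_mem_nhds]
  rintro ⟨⟨x₁, x₂⟩, hx⟩ ⟨⟨⟨y₁, y₂⟩, hy⟩, hxy, hg⟩
  change limitRel A C (x₁, x₂) (y₁, y₂) at hxy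
  change prodAction f₁ f₂ g (x₁, x₂) = (y₁, y₂) at hg
  have hlim := ho.mem_nhds (x := ⟨(x₁, x₂), hx⟩) (by
    change limitRel A C (x₁, x₂) (prodAction f₁ f₂ g (x₁, x₂))
    rwa [hg])
  have g₁ : (f₁ ^ g.toAdd.1) x₁ = y₁ := congrArg Prod.fst hg
  have g₂ : (f₂ ^ g.toAdd.2) x₂ = y₂ := congrArg Prod.snd hg
  rcases hx with ⟨hx₁, hx₂⟩ | ⟨hx₁, hx₂⟩ <;> rcases hy with ⟨hy₁, hy₂⟩ | ⟨hy₁, hy₂⟩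
  · change x₁ = _ at hx₁
    change y₁ = _ at hy₁
    have n₁ := ((hU₁.compl.isOpen.preimage continuous_fst).preimage hc).mem_nhds
      (x := ⟨(x₁, x₂), Or.inl ⟨hx₁, hx₂⟩⟩) (show x₁ ∉ U₁ from hx₁ ▸ hA s)
    have n₂ := (((hU₂.isOpen.preimage (Homeomorph.continuous (f₂ ^ g.toAdd.2))).preimage
      continuous_snd).preimage hc).mem_nhds (x := ⟨(x₁, x₂), Or.inl ⟨hx₁, hx₂⟩⟩)
      (show (f₂ ^ g.toAdd.2) x₂ ∈ U₂ from g₂ ▸ hy₂)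
    filter_upwards [hlim, n₁, n₂]
    rintro ⟨⟨z₁, z₂⟩, hz⟩ h h₁ h₂
    rcases hz with ⟨hz₁, hz₂⟩ | ⟨hz₁, hz₂⟩
    · refine ⟨⟨prodAction f₁ f₂ g (z₁, z₂), Or.inl ⟨?_, h₂⟩⟩, h, rfl⟩
      change z₁ = _ at hz₁
      change (f₁ ^ g.toAdd.1) z₁ = _
      rw [hz₁, ← hx₁, g₁, hy₁, hx₁]
    · exact absurd hz₁ h₁
  · change x₁ = _ at hx₁
    change y₂ = _ at hy₂
    subst hx₁ hy₂
    exact absurd hxy (not_limitRel_of_mem_cross hA hC hx₂ hy₁)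
  · change y₁ = _ at hy₁
    change x₂ = _ at hx₂
    subst hy₁ hx₂
    exact absurd ((limitRel A C).symm hxy) (not_limitRel_of_mem_cross hA hC hy₂ hx₁)
  · change x₂ = _ at hx₂
    change y₂ = _ at hy₂
    have n₂ := ((hU₂.compl.isOpen.preimage continuous_snd).preimage hc).mem_nhds
      (x := ⟨(x₁, x₂), Or.inr ⟨hx₁, hx₂⟩⟩) (show x₂ ∉ U₂ from hx₂ ▸ hC s)
    have n₁ := (((hU₁.isOpen.preimage (Homeomorph.continuous (f₁ ^ g.toAdd.1))).preimage
      continuous_fst).preimage hc).mem_nhds (x := ⟨(x₁, x₂), Or.inr ⟨hx₁, hx₂⟩⟩)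
      (show (f₁ ^ g.toAdd.1) x₁ ∈ U₁ from g₁ ▸ hy₁)
    filter_upwards [hlim, n₁, n₂]
    rintro ⟨⟨z₁, z₂⟩, hz⟩ h h₁ h₂
    rcases hz with ⟨hz₁, hz₂⟩ | ⟨hz₁, hz₂⟩
    · exact absurd hz₂ h₂
    · refine ⟨⟨prodAction f₁ f₂ g (z₁, z₂), Or.inr ⟨h₁, ?_⟩⟩, h, rfl⟩
      change z₂ = _ at hz₂
      change (f₂ ^ g.toAdd.2) z₂ = _
      rw [hz₂, ← hx₂, g₂, hy₂, hx₂]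

theorem isClosed_cross [T1Space X₁] [T1Space X₂] (hU₁ : IsClosed U₁) (hU₂ : IsClosed U₂) (q₁ : X₁)
    (q₂ : X₂) : IsClosed (cross U₁ U₂ q₁ q₂) :=
  (isClosed_singleton.prod hU₂).union (hU₁.prod isClosed_singleton)

theorem beta_beta {X₁ X₂ : Type*} {U₁ : Set X₁} {U₂ : Set X₂} {q₁ r₁ : X₁} {q₂ r₂ : X₂} (hq : q₁ ∉ U₁) (hr : r₁ ∉ U₁)
    (x : cross U₁ U₂ q₁ q₂) : beta U₁ U₂ r₁ r₂ q₁ q₂ (beta U₁ U₂ q₁ q₂ r₁ r₂ x) = x := by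
  obtain ⟨⟨x₁, x₂⟩, ⟨hx₁, hx₂⟩ | ⟨hx₁, hx₂⟩⟩ := x
  · change x₁ = _ at hx₁
    subst hx₁
    rw [beta_left _ _ _ _ _ _ hx₂, beta_left _ _ _ _ _ _ hx₂]
  · change x₂ = _ at hx₂
    subst hx₂
    rw [beta_right _ _ _ _ _ _ hq hx₁, beta_right _ _ _ _ _ _ hr hx₁]

theorem continuous_beta {q₁ r₁ : X₁} {q₂ r₂ : X₂} (hU₂ : IsClopen U₂) (hq₂ : q₂ ∉ U₂) :
    Continuous (beta U₁ U₂ q₁ q₂ r₁ r₂) := by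
  classical
  refine Continuous.subtype_mk (f := fun x : cross U₁ U₂ q₁ q₂ =>
    if x.1.2 ∈ U₂ then (r₁, x.1.2) else (x.1.1, r₂)) ?_ ?_ |>.congr ?_
  rotate_left
  · intro x
    split_ifs with h
    · exact Or.inl ⟨rfl, h⟩
    · exact Or.inr ⟨(x.2.resolve_left fun h' => h h'.2).1, rfl⟩
  rotate_left
  · refine Continuous.if ?_ (by fun_prop) (by fun_prop)
    intro x hx
    have : IsClopen {x : cross U₁ U₂ q₁ q₂ | x.1.2 ∈ U₂} :=
      hU₂.preimage (continuous_snd.comp continuous_subtype_val)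
    rw [this.frontier_eq] at hx
    exact absurd hx (notMem_empty _)
  · intro x
    apply Subtype.ext
    by_cases h : x.1.2 ∈ U₂
    · have h' : x.1 ∈ ({q₁} : Set X₁) ×ˢ U₂ := by
        rcases x.2 with h' | h'
        · exact h'
        · exact absurd h (by rw [mem_singleton_iff.1 h'.2]; exact hq₂)
      simp only [beta, dif_pos h', if_pos h]
    · have h' : x.1 ∉ ({q₁} : Set X₁) ×ˢ U₂ := fun h' => h h'.2
      simp only [beta, dif_neg h', if_neg h]

theorem isHomeomorph_beta {q₁ r₁ : X₁} {q₂ r₂ : X₂} (hU₂ : IsClopen U₂) (hq₁ : q₁ ∉ U₁)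
    (hr₁ : r₁ ∉ U₁) (hq₂ : q₂ ∉ U₂) (hr₂ : r₂ ∉ U₂) :
    IsHomeomorph (beta U₁ U₂ q₁ q₂ r₁ r₂) :=
  isHomeomorph_iff_exists_inverse.2 ⟨continuous_beta hU₂ hq₂, beta U₁ U₂ r₁ r₂ q₁ q₂,
    beta_beta hq₁ hr₁, beta_beta hr₁ hq₁, continuous_beta hU₂ hr₂⟩

/-- On each arm the relation depends only on the moving coordinate, which `β` keeps; by freeness the
group element is trivial in the fixed coordinate, so `β` keeps it as well. -/
theorem inducesIso_beta {s t : Bool} (h₁ : ∀ k : ℤ, k ≠ 0 → ∀ x, (f₁ ^ k) x ≠ x)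
    (h₂ : ∀ k : ℤ, k ≠ 0 → ∀ x, (f₂ ^ k) x ≠ x) (hU₂ : IsClopen U₂)
    (hA : ∀ s, A.endpt s ∉ U₁) (hC : ∀ s, C.endpt s ∉ U₂) :
    let T := subTopology (limitRel_le_orbitRel (A := A) (C := C)) (orbitTopology _)
    InducesIso (restrictRel (limitRel A C) (cross U₁ U₂ (A.endpt s) (C.endpt s)))
      (restrictTopology T _)
      (restrictRel (limitRel A C) (cross U₁ U₂ (A.endpt t) (C.endpt t)))
      (restrictTopology T _) (beta U₁ U₂ (A.endpt s) (C.endpt s) (A.endpt t) (C.endpt t)) := by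
  intro T
  have hfree := isFreeAction_prodAction h₁ h₂
  refine inducesIso_of_cocycle_eq hfree (ι := Subtype.val) (ι' := Subtype.val) (fun _ _ h => limitRel_le_orbitRel h)
    (fun _ _ h => limitRel_le_orbitRel h) (restrictTopology_eq_induced hfree _ _)
    (restrictTopology_eq_induced hfree _ _) Subtype.val_injective
    (isHomeomorph_beta hU₂ (hA s) (hA t) (hC s) (hC t)) ?_ ?_
  · rintro ⟨⟨x₁, x₂⟩, ⟨hx₁, hx₂⟩ | ⟨hx₁, hx₂⟩⟩ ⟨⟨y₁, y₂⟩, ⟨hy₁, hy₂⟩ | ⟨hy₁, hy₂⟩⟩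
    · change x₁ = _ at hx₁; change y₁ = _ at hy₁; subst hx₁ hy₁
      rw [beta_left _ _ _ _ _ _ hx₂, beta_left _ _ _ _ _ _ hy₂]
      exact (limitRel_left_iff hC hx₂ hy₂).trans (limitRel_left_iff hC hx₂ hy₂).symm
    · change x₁ = _ at hx₁; change y₂ = _ at hy₂; subst hx₁ hy₂
      rw [beta_left _ _ _ _ _ _ hx₂, beta_right _ _ _ _ _ _ (hA s) hy₁]
      exact iff_of_false (not_limitRel_of_mem_cross hA hC hx₂ hy₁)
        (not_limitRel_of_mem_cross hA hC hx₂ hy₁)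
    · change x₂ = _ at hx₂; change y₁ = _ at hy₁; subst hx₂ hy₁
      rw [beta_left _ _ _ _ _ _ hy₂, beta_right _ _ _ _ _ _ (hA s) hx₁]
      exact iff_of_false (fun h => not_limitRel_of_mem_cross hA hC hy₂ hx₁ ((limitRel A C).symm h))
        (fun h => not_limitRel_of_mem_cross hA hC hy₂ hx₁ ((limitRel A C).symm h))
    · change x₂ = _ at hx₂; change y₂ = _ at hy₂; subst hx₂ hy₂
      rw [beta_right _ _ _ _ _ _ (hA s) hx₁, beta_right _ _ _ _ _ _ (hA s) hy₁]
      exact (limitRel_right_iff hA hx₁ hy₁).trans (limitRel_right_iff hA hx₁ hy₁).symm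
  · rintro ⟨⟨x₁, x₂⟩, ⟨hx₁, hx₂⟩ | ⟨hx₁, hx₂⟩⟩ ⟨⟨y₁, y₂⟩, ⟨hy₁, hy₂⟩ | ⟨hy₁, hy₂⟩⟩ g hxy hg
    · change x₁ = _ at hx₁; change y₁ = _ at hy₁; subst hx₁ hy₁
      rw [beta_left _ _ _ _ _ _ hx₂, beta_left _ _ _ _ _ _ hy₂]
      have e₁ : g.toAdd.1 = 0 := by_contra fun h => h₁ _ h _ (congrArg Prod.fst hg)
      have e₂ : (f₂ ^ g.toAdd.2) x₂ = y₂ := congrArg Prod.snd hg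
      exact Prod.ext (by change (f₁ ^ g.toAdd.1) _ = _; rw [e₁]; rfl) e₂
    · change x₁ = _ at hx₁; change y₂ = _ at hy₂; subst hx₁ hy₂
      exact absurd hxy (not_limitRel_of_mem_cross hA hC hx₂ hy₁)
    · change x₂ = _ at hx₂; change y₁ = _ at hy₁; subst hx₂ hy₁
      exact absurd ((limitRel A C).symm hxy) (not_limitRel_of_mem_cross hA hC hy₂ hx₁)
    · change x₂ = _ at hx₂; change y₂ = _ at hy₂; subst hx₂ hy₂
      rw [beta_right _ _ _ _ _ _ (hA s) hx₁, beta_right _ _ _ _ _ _ (hA s) hy₁]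
      have e₂ : g.toAdd.2 = 0 := by_contra fun h => h₂ _ h _ (congrArg Prod.snd hg)
      have e₁ : (f₁ ^ g.toAdd.1) x₁ = y₁ := congrArg Prod.fst hg
      exact Prod.ext e₁ (by change (f₂ ^ g.toAdd.2) _ = _; rw [e₂]; rfl)

end Product

/-! ### Thinness of the cross and generation of the orbit relation -/

section Main

variable {X₁ X₂ : Type*} [TopologicalSpace X₁] [TopologicalSpace X₂]
  {f₁ : X₁ ≃ₜ X₁} {f₂ : X₂ ≃ₜ X₂} {p₁ : X₁} {p₂ : X₂} {A : Towers f₁ p₁} {C : Towers f₂ p₂}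
  {U₁ : Set X₁} {U₂ : Set X₂}

theorem zpow_apply_injective {X : Type*} [TopologicalSpace X] {f : X ≃ₜ X}
    (hfree : ∀ k : ℤ, k ≠ 0 → ∀ x, (f ^ k) x ≠ x) (x : X) :
    Function.Injective fun k : ℤ => (f ^ k) x := by
  intro k l h
  by_contra hne
  apply hfree (k - l) (sub_ne_zero.2 hne) ((f ^ l) x)
  rw [← zpow_add_apply, sub_add_cancel]
  exact h

/-- A finite dense class would be closed, hence the whole space, which contains an infinite orbit.
-/
theorem infinite_limitRel [T1Space X₁] [T1Space X₂] (h₁ : ∀ k : ℤ, k ≠ 0 → ∀ x, (f₁ ^ k) x ≠ x)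
    (x : X₁ × X₂) : {y | limitRel A C x y}.Infinite := by
  intro hfin
  have huniv : {y | limitRel A C x y} = univ := by
    rw [← hfin.isClosed.closure_eq]
    exact (isMinimalRel_limitRel x).closure_eq
  rw [huniv] at hfin
  refine infinite_of_injective_forall_mem (f := fun k : ℤ => ((f₁ ^ k) x.1, x.2)) ?_
    (fun _ => mem_univ _) hfin
  intro k l h
  exact zpow_apply_injective h₁ x.1 (congrArg Prod.fst h)

theorem Towers.exists_eq_zpow_endpt {X : Type*} [TopologicalSpace X] {f : X ≃ₜ X} {p : X}
    (A : Towers f p) {n : ℕ} {x : X} {s : Bool} (h : A.rel n x (A.endpt s)) :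
    x ∈ range fun a : Bool × ℤ => (f ^ a.2) (A.endpt a.1) := by
  obtain ⟨k, hk⟩ := A.exists_zpow ((A.rel n).symm h)
  exact ⟨(s, k), hk⟩

theorem cond_neg_eq (s : Bool) (k : ℕ) : (k : ℤ) * cond s (-1) 1 = cond s (-(k : ℤ)) k := by
  cases s <;> simp

theorem prodAction_ofAdd_pow_apply (c : ℤ × ℤ) (k : ℕ) (x : X₁ × X₂) :
    prodAction f₁ f₂ (Multiplicative.ofAdd c ^ k) x =
      ((f₁ ^ (k * c.1)) x.1, (f₂ ^ (k * c.2)) x.2) := by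
  rw [← ofAdd_nsmul, prodAction_apply]
  simp

/-- Each arm is pushed away from its cut. The only points that may leave their class are those of
the orbit of `p` on the arm, which form a countable set. -/
theorem isThin_cross [T1Space X₁] [T1Space X₂] (h₁ : ∀ k : ℤ, k ≠ 0 → ∀ x, (f₁ ^ k) x ≠ x)
    (h₂ : ∀ k : ℤ, k ≠ 0 → ∀ x, (f₂ ^ k) x ≠ x) (hU₁ : IsClosed U₁) (hU₂ : IsClosed U₂) (s : Bool) :
    IsThin (limitRel A C)
      (subTopology (limitRel_le_orbitRel (A := A) (C := C)) (orbitTopology (prodAction f₁ f₂)))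
      (cross U₁ U₂ (A.endpt s) (C.endpt s)) := by
  intro μ hprob hinv
  let _ : MeasurableSpace (X₁ × X₂) := borel _
  have : BorelSpace (X₁ × X₂) := ⟨rfl⟩
  have hfree := isFreeAction_prodAction h₁ h₂
  have hnull := fun {D E : Set (X₁ × X₂)} =>
    measure_eq_zero_of_translates (A := D) (C := E) (μ := μ) hfree
    (limitRel_le_orbitRel (A := A) (C := C)) (subTopology_eq_induced hfree _) hinv isOpen_limitRel
    (infinite_limitRel h₁)
  refine MeasureTheory.measure_union_null ?_ ?_
  · refine hnull (E := {A.endpt s} ×ˢ range fun a : Bool × ℤ => (f₂ ^ a.2) (C.endpt a.1))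
      (isClosed_singleton.prod hU₂).measurableSet ((countable_singleton _).prod (countable_range _))
      -- The direction away from the cut: backwards from `p₁`, forwards from `f₁ p₁`.
      (Multiplicative.ofAdd (cond s (-1) 1, 0)) ?_ ?_
    · rintro k ⟨x₁, x₂⟩ ⟨hx, -⟩ hxC
      change x₁ = _ at hx
      subst hx
      obtain ⟨n, hn⟩ := A.exists_rel_iterate h₁ s k
      rw [prodAction_ofAdd_pow_apply, cond_neg_eq, mul_zero, zpow_zero, Homeomorph.one_apply]
      obtain h | ⟨s₁, s₂, h⟩ := limitRel_or_corner (A := A) (C := C) (N := n)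
        (x := (A.endpt s, x₂)) (y := ((f₁ ^ cond s (-(k : ℤ)) k) (A.endpt s), x₂)) hn
        ((C.rel n).refl _)
      · exact h
      · exact absurd ⟨rfl, C.exists_eq_zpow_endpt (C.rel_endpt fun n hn =>
          congrArg Prod.snd (h n hn))⟩ hxC
    · rintro k l ⟨x₁, x₂⟩ ⟨hx, -⟩ ⟨y₁, y₂⟩ ⟨hy, -⟩ h
      change x₁ = _ at hx
      change y₁ = _ at hy
      rw [prodAction_ofAdd_pow_apply, prodAction_ofAdd_pow_apply, hx, hy] at h
      have := zpow_apply_injective h₁ _ (congrArg Prod.fst h)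
      cases s <;> simpa using this
  · refine hnull (E := (range fun a : Bool × ℤ => (f₁ ^ a.2) (A.endpt a.1)) ×ˢ {C.endpt s})
      (hU₁.prod isClosed_singleton).measurableSet ((countable_range _).prod (countable_singleton _))
      (Multiplicative.ofAdd (0, cond s (-1) 1)) ?_ ?_
    · rintro k ⟨x₁, x₂⟩ ⟨-, hx⟩ hxC
      change x₂ = _ at hx
      subst hx
      obtain ⟨n, hn⟩ := C.exists_rel_iterate h₂ s k
      rw [prodAction_ofAdd_pow_apply, cond_neg_eq, mul_zero, zpow_zero, Homeomorph.one_apply]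
      obtain h | ⟨s₁, s₂, h⟩ := limitRel_or_corner (A := A) (C := C) (N := n)
        (x := (x₁, C.endpt s)) (y := (x₁, (f₂ ^ cond s (-(k : ℤ)) k) (C.endpt s)))
        ((A.rel n).refl _) hn
      · exact h
      · exact absurd ⟨A.exists_eq_zpow_endpt (A.rel_endpt fun n hn =>
          congrArg Prod.fst (h n hn)), rfl⟩ hxC
    · rintro k l ⟨x₁, x₂⟩ ⟨-, hx⟩ ⟨y₁, y₂⟩ ⟨-, hy⟩ h
      change x₂ = _ at hx
      change y₂ = _ at hy
      rw [prodAction_ofAdd_pow_apply, prodAction_ofAdd_pow_apply, hx, hy] at h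
      have := zpow_apply_injective h₂ _ (congrArg Prod.snd h)
      cases s <;> simpa using this

/-- First the eight pieces of the orbit of `p` are joined. Then any two points of a common tile are
related, and every cut can be crossed. -/
theorem orbitRel_le_of_limitRel_le (hU₁ : IsOpen U₁) (hU₂ : IsOpen U₂) (hne₁ : U₁.Nonempty)
    (hne₂ : U₂.Nonempty) (hA : ∀ s, A.endpt s ∉ U₁) (hC : ∀ s, C.endpt s ∉ U₂)
    {S : Setoid (X₁ × X₂)} (hS : limitRel A C ≤ S)
    (hl : ∀ x₂ ∈ U₂, S (A.endpt true, x₂) (A.endpt false, x₂))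
    (hr : ∀ x₁ ∈ U₁, S (x₁, C.endpt true) (x₁, C.endpt false))
    (h₁ : S (A.endpt true, C.endpt true) (A.endpt true, C.endpt false))
    (h₂ : S (A.endpt true, C.endpt false) (A.endpt false, C.endpt false))
    (h₃ : S (A.endpt false, C.endpt false) (A.endpt false, C.endpt true)) :
    orbitRel (prodAction f₁ f₂) ≤ S := by
  obtain ⟨N₁, hN₁⟩ := A.exists_mem hU₁ hne₁
  obtain ⟨N₂, hN₂⟩ := C.exists_mem hU₂ hne₂
  -- The points `w s` and `u s` represent the horizontal and vertical pieces. They lie in `U₁` and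
  -- `U₂`, so they avoid the endpoints and `β` is defined at them.
  choose w hwU hw using fun s => hN₁ N₁ le_rfl (A.endpt s)
  choose u huU hu using fun s => hN₂ N₂ le_rfl (C.endpt s)
  have quad : ∀ {N s₁ s₂} {x : X₁ × X₂}, A.rel N x.1 (A.endpt s₁) → C.rel N x.2 (C.endpt s₂) →
      (limitRel A C x (A.endpt s₁, u s₂) ∧ ∀ n ≥ max N (max N₁ N₂), piece A C n x = false) ∨
      (limitRel A C x (w s₁, C.endpt s₂) ∧ ∀ n ≥ max N (max N₁ N₂), piece A C n x = true) := by
    intro N s₁ s₂ x hx₁ hx₂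
    exact limitRel_quadrant (A.rel_mono (le_max_left _ _) hx₁) (C.rel_mono (le_max_left _ _) hx₂)
      (A.rel_mono (by omega) ((A.rel _).symm (hw s₁))) (C.rel_mono (by omega) ((C.rel _).symm (hu s₂)))
      (fun h => hA s₁ (h ▸ hwU s₁)) fun h => hC s₂ (h ▸ huU s₂)
  have corner_eq : ∀ s, S (A.endpt s, C.endpt s) (A.endpt s, u s) := by
    intro s
    obtain h | h := quad (N := 0) (x := (A.endpt s, C.endpt s)) ((A.rel 0).refl _) ((C.rel 0).refl _)
    · exact hS h.1
    · have := h.2 _ le_rfl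
      rw [piece_corner] at this
      simp at this
  have corner_ne : ∀ s t, s ≠ t → S (A.endpt s, C.endpt t) (w s, C.endpt t) := by
    intro s t hst
    obtain h | h := quad (N := 0) (x := (A.endpt s, C.endpt t)) ((A.rel 0).refl _) ((C.rel 0).refl _)
    · have := h.2 _ le_rfl
      rw [piece_corner] at this
      simp [hst] at this
    · exact hS h.1
  -- All eight representatives are reached from this corner: `h₁`, `h₂` and `h₃` lead alternately to
  -- horizontal and vertical pieces, and `hl` and `hr` give the partner of each piece reached.
  set a : X₁ × X₂ := (A.endpt true, C.endpt true)
  have vertical : ∀ s t, S a (A.endpt s, u t) := by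
    have htt : S a (A.endpt true, u true) := corner_eq true
    have hff : S a (A.endpt false, u false) :=
      S.trans h₁ (S.trans h₂ (corner_eq false))
    intro s t
    cases s <;> cases t
    · exact hff
    · exact S.trans htt (hl _ (huU true))
    · exact S.trans hff (S.symm (hl _ (huU false)))
    · exact htt
  have horizontal : ∀ s t, S a (w s, C.endpt t) := by
    have htf : S a (w true, C.endpt false) := S.trans h₁ (corner_ne true false (by decide))
    have hft : S a (w false, C.endpt true) :=
      S.trans h₁ (S.trans h₂ (S.trans h₃ (corner_ne false true (by decide))))
    intro s t
    cases s <;> cases t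
    · exact S.trans hft (hr _ (hwU false))
    · exact hft
    · exact htf
    · exact S.trans htf (S.symm (hr _ (hwU true)))
  have quad' : ∀ {N s₁ s₂} {x : X₁ × X₂}, A.rel N x.1 (A.endpt s₁) → C.rel N x.2 (C.endpt s₂) →
      S a x := by
    intro N s₁ s₂ x hx₁ hx₂
    obtain h | h := quad hx₁ hx₂
    · exact S.trans (vertical _ _) (S.symm (hS h.1))
    · exact S.trans (horizontal _ _) (S.symm (hS h.1))
  have step : ∀ {N} {x y : X₁ × X₂}, A.rel N x.1 y.1 → C.rel N x.2 y.2 → S x y := by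
    intro N x y hx hy
    obtain h | ⟨s₁, s₂, h⟩ := limitRel_or_corner hx hy
    · exact hS h
    · have e₁ := A.rel_endpt fun n hn => congrArg Prod.fst (h n hn)
      have e₂ := C.rel_endpt fun n hn => congrArg Prod.snd (h n hn)
      exact S.trans (S.symm (quad' e₁ e₂)) (quad' ((A.rel N).trans ((A.rel N).symm hx) e₁)
        ((C.rel N).trans ((C.rel N).symm hy) e₂))
  refine orbitRel_le_of_generators ?_ ?_
  · rintro ⟨x₁, x₂⟩
    by_cases hx : x₁ = p₁
    · subst hx
      -- To cross the cut, move along it to a point over `U₂`, apply `β`, and move back on the other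
      -- side.
      obtain ⟨y₂, hy₂, hxy⟩ := hN₂ N₂ le_rfl x₂
      have e : ∀ s, S (A.endpt s, x₂) (A.endpt s, y₂) := fun s => step ((A.rel N₂).refl _) hxy
      exact S.trans (e true) (S.trans (hl _ hy₂) (S.symm (e false)))
    · obtain ⟨n, hn⟩ := A.exists_rel_apply hx
      exact step hn ((C.rel n).refl _)
  · rintro ⟨x₁, x₂⟩
    by_cases hx : x₂ = p₂
    · subst hx
      obtain ⟨y₁, hy₁, hxy⟩ := hN₁ N₁ le_rfl x₁
      have e : ∀ s, S (x₁, C.endpt s) (y₁, C.endpt s) := fun s => step hxy ((C.rel N₁).refl _)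
      exact S.trans (e true) (S.trans (hr _ hy₁) (S.symm (e false)))
    · obtain ⟨n, hn⟩ := C.exists_rel_apply hx
      exact step ((A.rel n).refl _) hn

end Main

end CantorOrbit

/-! ### Assembly of the five assertions -/

open CantorOrbit
theorem mainTheorem2 {X₁ X₂ : Type*} [TopologicalSpace X₁] [TopologicalSpace X₂]
    (φ₁ : X₁ ≃ₜ X₁) (φ₂ : X₂ ≃ₜ X₂)
    (hφ₁ : IsCantorMinimalSystem (intAction φ₁)) (hφ₂ : IsCantorMinimalSystem (intAction φ₂))
    (p₁ : X₁) (p₂ : X₂) (U₁ : Set X₁) (U₂ : Set X₂)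
    (hU₁ : IsClopen U₁) (hU₂ : IsClopen U₂) (hne₁ : U₁.Nonempty) (hne₂ : U₂.Nonempty)
    (hp₁ : p₁ ∉ U₁) (hφp₁ : φ₁ p₁ ∉ U₁) (hp₂ : p₂ ∉ U₂) (hφp₂ : φ₂ p₂ ∉ U₂) :
    let φ := prodAction φ₁ φ₂
    let p : X₁ × X₂ := (p₁, p₂)
    let B := cross U₁ U₂ p₁ p₂
    let Bstar := cross U₁ U₂ (φ₁ p₁) (φ₂ p₂)
    let β : B → Bstar := beta U₁ U₂ p₁ p₂ (φ₁ p₁) (φ₂ p₂)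
    let act : ℤ × ℤ → X₁ × X₂ → X₁ × X₂ := fun a => φ (Multiplicative.ofAdd a)
    ∃ (R' : Setoid (X₁ × X₂)) (hR' : R' ≤ orbitRel φ),
      let T := subTopology hR' (orbitTopology φ)
      (IsMinimalRel R' ∧ IsAF R' T) ∧
      ((IsClosed B ∧ IsEtaleSubset R' T B ∧ IsThin R' T B) ∧
        (IsClosed Bstar ∧ IsEtaleSubset R' T Bstar ∧ IsThin R' T Bstar)) ∧
      (∀ x ∈ B, ∀ y ∈ Bstar, ¬ R' x y) ∧
      InducesIso (restrictRel R' B) (restrictTopology T B)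
        (restrictRel R' Bstar) (restrictTopology T Bstar) β ∧
      orbitRel φ = Relation.EqvGen.setoid (fun x y : X₁ × X₂ =>
        R' x y ∨ (∃ hx : x ∈ B, (β ⟨x, hx⟩ : X₁ × X₂) = y) ∨
        (x, y) ∈ ({(p, act (0, 1) p), (act (0, 1) p, act (1, 1) p),
          (act (1, 1) p, act (1, 0) p)} : Set ((X₁ × X₂) × (X₁ × X₂)))) := by
  intro φ p B Bstar β act
  have := hφ₁.isCantorSet.compactSpace
  have := hφ₂.isCantorSet.compactSpace
  have := hφ₁.isCantorSet.t2Space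
  have := hφ₂.isCantorSet.t2Space
  have := hφ₁.isCantorSet.secondCountableTopology
  have := hφ₂.isCantorSet.secondCountableTopology
  have := hφ₁.isCantorSet.totallyDisconnectedSpace
  have := hφ₂.isCantorSet.totallyDisconnectedSpace
  have : Countable (Multiplicative (ℤ × ℤ)) := inferInstanceAs (Countable (ℤ × ℤ))
  have h₁ := hφ₁.zpow_apply_ne
  have h₂ := hφ₂.zpow_apply_ne
  have hfree : IsFreeAction φ := isFreeAction_prodAction h₁ h₂
  obtain ⟨A⟩ := exists_towers p₁ h₁ hφ₁.dense_zpow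
  obtain ⟨C⟩ := exists_towers p₂ h₂ hφ₂.dense_zpow
  have hA : ∀ s, A.endpt s ∉ U₁ := by
    intro s; cases s
    · exact hφp₁
    · exact hp₁
  have hC : ∀ s, C.endpt s ∉ U₂ := by
    intro s; cases s
    · exact hφp₂
    · exact hp₂
  have hclosed : ∀ s, IsClosed (cross U₁ U₂ (A.endpt s) (C.endpt s)) := fun s =>
    isClosed_cross hU₁.isClosed hU₂.isClosed _ _
  have hle : limitRel A C ≤ orbitRel φ := limitRel_le_orbitRel
  have hetale : ∀ s, IsEtaleSubset (limitRel A C) (subTopology hle (orbitTopology φ))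
      (cross U₁ U₂ (A.endpt s) (C.endpt s)) := by
    intro s
    have := (hclosed s).locallyCompactSpace
    exact isEtale_of_isOpen hfree IsEmbedding.subtypeVal (fun _ _ h => hle h)
      (isOpen_limitRel_cross hU₁ hU₂ hA hC s) (restrictTopology_eq_induced hfree _ _)
  have hthin : ∀ s, IsThin (limitRel A C) (subTopology hle (orbitTopology φ))
      (cross U₁ U₂ (A.endpt s) (C.endpt s)) :=
    isThin_cross h₁ h₂ hU₁.isClosed hU₂.isClosed
  refine ⟨limitRel A C, hle, ⟨isMinimalRel_limitRel, ?_, tileRel A C, monotone_tileRel, tileRel_le,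
    fun n => ?_, fun _ _ h => h⟩, ⟨⟨hclosed true, hetale true, hthin true⟩,
    hclosed false, hetale false, hthin false⟩, ?_,
    inducesIso_beta (s := true) (t := false) h₁ h₂ hU₂ hA hC, ?_⟩
  · refine isEtale_of_isOpen hfree IsEmbedding.id (fun _ _ h => hle h) (fun g => ?_)
      (subTopology_eq_induced hfree _)
    convert isOpen_limitRel (A := A) (C := C) g using 3 with x
    exact ⟨fun ⟨y, hy, h⟩ => (show φ g x = y from h) ▸ hy, fun h => ⟨_, h, rfl⟩⟩
  · exact isCompact_and_isOpen_of_isClopen hfree hle (tileRel_le n) (isClopen_tileRel n)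
      (finite_tileRel n) (subTopology_eq_induced hfree _)
  · rintro ⟨x₁, x₂⟩ (⟨hx₁, hx₂⟩ | ⟨hx₁, hx₂⟩) ⟨y₁, y₂⟩ (⟨hy₁, hy₂⟩ | ⟨hy₁, hy₂⟩) h
    -- Points of parallel arms lie on opposite sides of a cut, which no tile crosses; perpendicular
    -- arms are separated by the division into pieces.
    · obtain ⟨n, h, -⟩ := h
      change x₁ = _ at hx₁; change y₁ = _ at hy₁; subst hx₁ hy₁
      exact A.not_rel n h
    · change x₁ = _ at hx₁; change y₂ = _ at hy₂; subst hx₁ hy₂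
      exact not_limitRel_of_mem_cross (s := true) (t := false) hA hC hx₂ hy₁ h
    · change x₂ = _ at hx₂; change y₁ = _ at hy₁; subst hx₂ hy₁
      exact not_limitRel_of_mem_cross (s := false) (t := true) hA hC hy₂ hx₁
        ((limitRel A C).symm h)
    · obtain ⟨n, -, h, -⟩ := h
      change x₂ = _ at hx₂; change y₂ = _ at hy₂; subst hx₂ hy₂
      exact C.not_rel n h
  · have act₁ : ∀ x : X₁ × X₂, orbitRel φ x (φ₁ x.1, x.2) := fun x =>
      ⟨Multiplicative.ofAdd (1, 0), rfl⟩
    have act₂ : ∀ x : X₁ × X₂, orbitRel φ x (x.1, φ₂ x.2) := fun x =>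
      ⟨Multiplicative.ofAdd (0, 1), rfl⟩
    apply le_antisymm
    · refine orbitRel_le_of_limitRel_le (A := A) (C := C) hU₁.isOpen hU₂.isOpen hne₁ hne₂ hA hC
        (fun x y h => .rel _ _ (Or.inl h)) (fun x₂ hx => ?_) (fun x₁ hx => ?_) ?_ ?_ ?_
      · exact .rel _ _ (Or.inr (Or.inl ⟨Or.inl ⟨rfl, hx⟩,
          congrArg Subtype.val (beta_left U₁ U₂ p₁ p₂ _ _ hx)⟩))
      · exact .rel _ _ (Or.inr (Or.inl ⟨Or.inr ⟨hx, rfl⟩,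
          congrArg Subtype.val (beta_right U₁ U₂ p₁ p₂ _ _ hp₁ hx)⟩))
      · exact .rel _ _ (Or.inr (Or.inr (Or.inl rfl)))
      · exact .rel _ _ (Or.inr (Or.inr (Or.inr (Or.inl rfl))))
      · exact .rel _ _ (Or.inr (Or.inr (Or.inr (Or.inr rfl))))
    · refine Setoid.eqvGen_le ?_
      rintro x y (h | ⟨hx, rfl⟩ | h | h | h)
      · exact hle h
      · obtain ⟨x₁, x₂⟩ := x
        rcases hx with ⟨hx₁, hx₂⟩ | ⟨hx₁, hx₂⟩
        · change x₁ = _ at hx₁; subst hx₁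
          simp only [β, beta_left _ _ _ _ _ _ hx₂]
          exact act₁ _
        · change x₂ = _ at hx₂; subst hx₂
          simp only [β, beta_right _ _ _ _ _ _ hp₁ hx₁]
          exact act₂ _
      · obtain ⟨rfl, rfl⟩ := Prod.mk.inj h
        exact act₂ _
      · obtain ⟨rfl, rfl⟩ := Prod.mk.inj h
        exact act₁ _
      · obtain ⟨rfl, rfl⟩ := Prod.mk.inj h
        exact (orbitRel φ).symm (act₂ _)
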